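/- Let $\mathbb F$ be a field and let $\Gamma=\mathbb F^{+}\rtimes\mathbb F^{\times}$ be the group of pairs $(a,b)$, $a\in\mathbb F$, $b\in\mathbb F\setminus\{0\}$, with $(a,b)\circ(c,d)=(a+bc,bd)$, acting on $\mathbb F$ by $(a,b)\cdot x=a+bx$. Write $\mathbb F^{+}$ also for the normal subgroup $\{(a,1)\}$ of $\Gamma$, and let $\mathcal A$ be the set of stabilizers in $\Gamma$ of the points of $\mathbb F$. Let $G$ be a graph with finitely many edges (loops and parallel edges allowed), let $D$ be an orientation of $G$, and let $\psi$ be a $\Gamma$-gain function for $G$: it assigns an element $\psi(e,u,v)\in\Gamma$ to every edge $e$ with ends $u,v$ and every choice of direction from $u$ to $v$, with $\psi(e,u,v)=\psi(e,v,u)^{-1}$ if $u\neq v$. *Definitions.* For any group-valued gain function, a cycle is balanced if the product of the gains along some simple closed walk around it is the identity. Let $\psi/\mathbb F^{+}$ be the induced $(\Gamma/\mathbb F^{+})$-gain function, and let $F(G,\psi/\mathbb F^{+})$ be its frame matroid: the matroid on $E(G)$ whose circuits are the $(\psi/\mathbb F^{+})$-balanced cycles and the tight handcuffs (two edge-disjoint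 cycles with exactly one common vertex), loose handcuffs (two vertex-disjoint cycles with a minimal path connecting them) and theta graphs (three internally disjoint paths with the same two distinct ends) in which no cycle is $(\psi/\mathbb F^{+})$-balanced. Let $\mathcal C$ be the set of circuits $C$ of $F(G,\psi/\mathbb F^{+})$ such that either $C$ is a $\psi$-balanced cycle, or $C$ is a handcuff or theta graph and there are $\eta\colon V(G)\to\Gamma$ and $A\in\mathcal A$ with $\eta(u)^{-1}\psi(e,u,v)\eta(v)\in A$ for every $e\in C$ and each direction $u\to v$ of $e$. A set $\mathcal D$ of circuits of a matroid $N$ is a linear class if, whenever $C_1,C_2\in\mathcal D$ and $|C_1\cup C_2|-r_N(C_1\cup C_2)=2$, every circuit of $N$ contained in $C_1\cup C_2$ is in $\mathcal D$. The matroid $M(\mathbb F^{+}\rtimes\mathbb F^{\times},\mathbb F^{+},\mathcal A,G,\psi)$ is the elementary lift of $N=F(G,\psi/\mathbb F^{+})$ given by the linear class $\mathcal C$, that is, the matroid on $E(G)$ with rank function $r(X)=r_N(X)$ if every circuit of $N$ contained in $X$ is in $\mathcal C$, and $r(X)=r_N(X)+1$ otherwise. Finally, $A(D,\psi)$ is the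 matrix over $\mathbb F$ with rows indexed by $V(G)\cup\{v_0\}$, where $v_0\notin V(G)$, and columns indexed by $E(G)$, such that if $e$ is oriented in $D$ from $v$ to $w$ and $\psi(e,v,w)=(a,b)$, then $$A(D,\psi)_{u,e}=\begin{cases} a & \text{if } u=v_0,\\ 1 & \text{if } u=v\neq w,\\ -b & \text{if } u=w\neq v,\\ 1-b & \text{if } u=v=w,\\ 0 & \text{otherwise.}\end{cases}$$ **Theorem.** Every non-identity element of $\Gamma$ lies in exactly one subgroup in $\{\mathbb F^{+}\}\cup\mathcal A$, each $B\in\mathcal A$ is malnormal ($g^{-1}Bg\cap B$ is trivial for all $g\in\Gamma\setminus B$), and $\mathcal A$ is closed under conjugation. The matroid $M(\mathbb F^{+}\rtimes\mathbb F^{\times},\mathbb F^{+},\mathcal A,G,\psi)$ is well defined: $F(G,\psi/\mathbb F^{+})$ exists, $\mathcal C$ is a linear class of its circuits, and there is exactly one such elementary lift. The matrix $A(D,\psi)$ represents this matroid over $\mathbb F$: a set of edges of $G$ is independent in it if and only if the columns of $A(D,\psi)$ that it indexes are linearly independent over $\mathbb F$. -/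

import Mathlib

namespace GainGraph

universe u v w

variable {V : Type u} {E : Type v}

/-! ### Walks, paths, cycles, handcuffs and theta graphs in a multigraph

Graphs are Mathlib's `Graph V E`: loops and parallel edges are allowed, and subgraphs without
isolated vertices are identified with their edge sets. -/

/-- Walks in a multigraph `G`, from a vertex to a vertex. -/
inductive Walk (G : Graph V E) : V → V → Type (max u v)
  | nil {x : V} (hx : x ∈ G.vertexSet) : Walk G x x
  | cons {x y z : V} (e : E) (h : G.IsLink e x y) (p : Walk G y z) : Walk G x z

namespace Walk

variable {G : Graph V E}

/-- The vertices of a walk, in order. -/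
def support : {x y : V} → Walk G x y → List V
  | x, _, nil _ => [x]
  | x, _, cons _ _ p => x :: p.support

/-- The edges of a walk, in order. -/
def edges : {x y : V} → Walk G x y → List E
  | _, _, nil _ => []
  | _, _, cons e _ p => e :: p.edges

/-- The set of vertices of a walk. -/
def vertices {x y : V} (p : Walk G x y) : Set V := {z | z ∈ p.support}

/-- The set of edges of a walk. -/
def edgeSet {x y : V} (p : Walk G x y) : Set E := {e | e ∈ p.edges}

/-- A path is a walk without repeated vertices. -/
def IsPath {x y : V} (p : Walk G x y) : Prop := p.support.Nodup

/-- A simple closed walk: at least one edge, no repeated edge, and no repeated vertex except that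
the first vertex is also the last. (One loop, or two parallel edges, give such a walk.) -/
def IsSimpleClosed {x : V} (p : Walk G x x) : Prop :=
  p.edges ≠ [] ∧ p.edges.Nodup ∧ p.support.tail.Nodup

end Walk

/-- The set of vertices incident with an edge of `X`, that is, the vertex set of `G[X]`. -/
def vertexSetOf (G : Graph V E) (X : Set E) : Set V := {x | ∃ e ∈ X, G.Inc e x}

/-- `C` is (the edge set of) a cycle of `G`. -/
def IsCycle (G : Graph V E) (C : Set E) : Prop :=
  ∃ (x : V) (p : Walk G x x), p.IsSimpleClosed ∧ p.edgeSet = C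

/-- Two edge-disjoint cycles with exactly one common vertex. -/
def IsTightHandcuff (G : Graph V E) (C : Set E) : Prop :=
  ∃ C₁ C₂ : Set E, IsCycle G C₁ ∧ IsCycle G C₂ ∧ Disjoint C₁ C₂ ∧
    (∃ x : V, vertexSetOf G C₁ ∩ vertexSetOf G C₂ = {x}) ∧ C = C₁ ∪ C₂

/-- Two vertex-disjoint cycles with a minimal path connecting them: the path meets each of the two
cycles only in one of its ends. -/
def IsLooseHandcuff (G : Graph V E) (C : Set E) : Prop :=
  ∃ C₁ C₂ : Set E, IsCycle G C₁ ∧ IsCycle G C₂ ∧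
    Disjoint (vertexSetOf G C₁) (vertexSetOf G C₂) ∧
    ∃ (x y : V) (p : Walk G x y), p.IsPath ∧ p.vertices ∩ vertexSetOf G C₁ = {x} ∧
      p.vertices ∩ vertexSetOf G C₂ = {y} ∧ C = C₁ ∪ p.edgeSet ∪ C₂

/-- A handcuff is a tight handcuff or a loose handcuff. -/
def IsHandcuff (G : Graph V E) (C : Set E) : Prop := IsTightHandcuff G C ∨ IsLooseHandcuff G C

/-- A theta graph: three paths between two distinct vertices that pairwise share no edge and no
vertex other than the two ends. -/
def IsTheta (G : Graph V E) (C : Set E) : Prop :=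
  ∃ (x y : V) (p q r : Walk G x y), x ≠ y ∧ p.IsPath ∧ q.IsPath ∧ r.IsPath ∧
    Disjoint p.edgeSet q.edgeSet ∧ Disjoint p.edgeSet r.edgeSet ∧ Disjoint q.edgeSet r.edgeSet ∧
    p.vertices ∩ q.vertices = {x, y} ∧ p.vertices ∩ r.vertices = {x, y} ∧
    q.vertices ∩ r.vertices = {x, y} ∧ C = p.edgeSet ∪ q.edgeSet ∪ r.edgeSet

/-! ### Gain functions -/

/-- A `Γ`-gain function for `G`. Its value at the oriented edge `(e, x, y)` is `ψ.gain e x y`;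
only the values at triples with `G.IsLink e x y` are ever used. Reversing a non-loop edge inverts
its gain; the gain of a loop is arbitrary. -/
structure GainFunction (G : Graph V E) (Γ : Type w) [Group Γ] where
  gain : E → V → V → Γ
  gain_symm : ∀ e x y, G.IsLink e x y → x ≠ y → gain e x y = (gain e y x)⁻¹

namespace GainFunction

variable {G : Graph V E} {Γ : Type w} [Group Γ]

/-- The product of the gains along a walk. -/
def walkGain (ψ : GainFunction G Γ) : {x y : V} → Walk G x y → Γ
  | _, _, Walk.nil _ => 1
  | x, _, Walk.cons (y := y) e _ p => ψ.gain e x y * ψ.walkGain p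

/-- The gain function `ψ^η` obtained by switching with `η`. -/
def switch (ψ : GainFunction G Γ) (η : V → Γ) : GainFunction G Γ where
  gain e x y := (η x)⁻¹ * ψ.gain e x y * η y
  gain_symm e x y h hne := by
    rw [ψ.gain_symm e x y h hne]
    group

/-- The induced `Γ ⧸ Γ₁`-gain function `ψ/Γ₁`. -/
def quotient (ψ : GainFunction G Γ) (Γ₁ : Subgroup Γ) [Γ₁.Normal] : GainFunction G (Γ ⧸ Γ₁) where
  gain e x y := (ψ.gain e x y : Γ ⧸ Γ₁)
  gain_symm e x y h hne := by
    rw [ψ.gain_symm e x y h hne, QuotientGroup.mk_inv]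

/-- The set `ψ(X)` of all gains of all orientations of edges in `X`. -/
def gains (ψ : GainFunction G Γ) (X : Set E) : Set Γ :=
  {g | ∃ e ∈ X, ∃ x y : V, G.IsLink e x y ∧ ψ.gain e x y = g}

/-- `C` is a `ψ`-balanced cycle: some simple closed walk on `C` has gain `1`. -/
def IsBalancedCycle (ψ : GainFunction G Γ) (C : Set E) : Prop :=
  ∃ (x : V) (p : Walk G x x), p.IsSimpleClosed ∧ p.edgeSet = C ∧ ψ.walkGain p = 1

/-- `C` is one of the sets that are to be the circuits of the frame matroid `F(G, ψ)`: a balanced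
cycle, or a tight handcuff, loose handcuff or theta graph all of whose cycles are unbalanced. -/
def IsFrameCircuit (ψ : GainFunction G Γ) (C : Set E) : Prop :=
  ψ.IsBalancedCycle C ∨
    ((IsHandcuff G C ∨ IsTheta G C) ∧ ∀ D ⊆ C, IsCycle G D → ¬ ψ.IsBalancedCycle D)

/-- `N` is the frame matroid `F(G, ψ)`. -/
def IsFrameMatroid (ψ : GainFunction G Γ) (N : Matroid E) : Prop :=
  N.E = G.edgeSet ∧ ∀ C : Set E, N.IsCircuit C ↔ ψ.IsFrameCircuit C

/-- The class `𝒞(Γ, Γ₁, 𝒜, G, ψ)` of circuits of `F(G, ψ/Γ₁)`. -/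
def circuitClass (Γ₁ : Subgroup Γ) [Γ₁.Normal] (𝒜 : Set (Subgroup Γ)) (ψ : GainFunction G Γ) :
    Set (Set E) :=
  {C | (ψ.quotient Γ₁).IsFrameCircuit C ∧
    (ψ.IsBalancedCycle C ∨
      ((IsHandcuff G C ∨ IsTheta G C) ∧
        ∃ (η : V → Γ), ∃ A ∈ 𝒜, (ψ.switch η).gains C ⊆ (A : Set Γ)))}

end GainFunction

/-! ### Frobenius partitions, linear classes and elementary lifts -/

/-- `A` is malnormal: for `g ∉ A`, the conjugate `g⁻¹ A g` meets `A` only in the identity. -/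
def IsMalnormal {Γ : Type w} [Group Γ] (A : Subgroup Γ) : Prop :=
  ∀ g : Γ, g ∉ A → ∀ a ∈ A, g⁻¹ * a * g ∈ A → g⁻¹ * a * g = 1

/-- `{Γ₁} ∪ 𝒜` is a Frobenius partition of `Γ`: every non-identity element lies in exactly one of
these subgroups, `Γ₁` is normal, each `A ∈ 𝒜` is malnormal, and `𝒜` is closed under conjugation. -/
def IsFrobeniusPartition {Γ : Type w} [Group Γ] (Γ₁ : Subgroup Γ) (𝒜 : Set (Subgroup Γ)) : Prop :=
  Γ₁.Normal ∧ (∀ g : Γ, g ≠ 1 → ∃! A : Subgroup Γ, A ∈ insert Γ₁ 𝒜 ∧ g ∈ A) ∧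
    (∀ A ∈ 𝒜, IsMalnormal A) ∧
    ∀ A ∈ 𝒜, ∀ g : Γ, A.map (MulAut.conj g).toMonoidHom ∈ 𝒜

/-- `𝒞` is a linear class of circuits of `N`. -/
def IsLinearClass (N : Matroid E) (𝒞 : Set (Set E)) : Prop :=
  (∀ C ∈ 𝒞, N.IsCircuit C) ∧
    ∀ C₁ ∈ 𝒞, ∀ C₂ ∈ 𝒞, (C₁ ∪ C₂).encard = N.eRk (C₁ ∪ C₂) + 2 →
      ∀ C, N.IsCircuit C → C ⊆ C₁ ∪ C₂ → C ∈ 𝒞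

open Classical in
/-- `M` is the elementary lift of `N` given by the linear class `𝒞`, through its rank function. -/
def IsLiftOf (N : Matroid E) (𝒞 : Set (Set E)) (M : Matroid E) : Prop :=
  IsLinearClass N 𝒞 ∧ M.E = N.E ∧
    ∀ X ⊆ N.E, M.eRk X =
      if ∀ C ⊆ X, N.IsCircuit C → C ∈ 𝒞 then N.eRk X else N.eRk X + 1

/-- `M` is the matroid `M(Γ, Γ₁, 𝒜, G, ψ)`: the elementary lift of the frame matroid `F(G, ψ/Γ₁)`
given by the linear class `𝒞(Γ, Γ₁, 𝒜, G, ψ)`. -/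
def IsGainMatroid {G : Graph V E} {Γ : Type w} [Group Γ] (Γ₁ : Subgroup Γ) [Γ₁.Normal]
    (𝒜 : Set (Subgroup Γ)) (ψ : GainFunction G Γ) (M : Matroid E) : Prop :=
  ∃ N : Matroid E, (ψ.quotient Γ₁).IsFrameMatroid N ∧ IsLiftOf N (ψ.circuitClass Γ₁ 𝒜) M

/-- The matrix `A`, with columns indexed by the set `S`, represents `M`: the matroid `M` is the
vector matroid of `A`. -/
def Represents {F : Type w} [Field F] {R : Type*} {S : Set E} (A : Matrix R S F)
    (M : Matroid E) : Prop :=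
  M.E = S ∧ ∀ I : Set S, M.Indep (Subtype.val '' I) ↔ LinearIndepOn F A.col I

/-! ### The group `𝔽⁺ ⋊ 𝔽ˣ` -/

/-- The action of `𝔽ˣ` on `𝔽⁺` by scaling. -/
def scaling (F : Type w) [Field F] : Fˣ →* MulAut (Multiplicative F) :=
  (MulAutMultiplicative F).symm.toMonoidHom.comp (DistribMulAction.toAddAut Fˣ F)

/-- The group `𝔽⁺ ⋊ 𝔽ˣ`, with `(a, b) ∘ (c, d) = (a + b c, b d)`. -/
abbrev AffineGroup (F : Type w) [Field F] : Type w :=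
  SemidirectProduct (Multiplicative F) Fˣ (scaling F)

/-- The additive component `a` of `(a, b)`. -/
def AffineGroup.trans {F : Type w} [Field F] (g : AffineGroup F) : F := g.left.toAdd

/-- The multiplicative component `b` of `(a, b)`, as an element of `𝔽`. -/
def AffineGroup.scale {F : Type w} [Field F] (g : AffineGroup F) : F := (g.right : F)

theorem AffineGroup.trans_mul {F : Type w} [Field F] (g h : AffineGroup F) :
    AffineGroup.trans (g * h) =
      AffineGroup.trans g + AffineGroup.scale g * AffineGroup.trans h := rfl

theorem AffineGroup.scale_mul {F : Type w} [Field F] (g h : AffineGroup F) :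
    AffineGroup.scale (g * h) = AffineGroup.scale g * AffineGroup.scale h := rfl

/-- The pair `(a, b)` acts on `𝔽` as the affine map `x ↦ a + b x`. -/
instance AffineGroup.instMulAction (F : Type w) [Field F] : MulAction (AffineGroup F) F where
  smul g x := AffineGroup.trans g + AffineGroup.scale g * x
  one_smul x := by
    change (0 : F) + 1 * x = x
    ring
  mul_smul g h x := by
    change AffineGroup.trans (g * h) + AffineGroup.scale (g * h) * x =
      AffineGroup.trans g +
        AffineGroup.scale g * (AffineGroup.trans h + AffineGroup.scale h * x)
    rw [AffineGroup.trans_mul, AffineGroup.scale_mul]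
    ring

/-- The subgroup `𝔽⁺` of translations `(a, 1)`. -/
def translations (F : Type w) [Field F] : Subgroup (AffineGroup F) :=
  (SemidirectProduct.inl : Multiplicative F →* AffineGroup F).range

instance translations_normal (F : Type w) [Field F] : (translations F).Normal := by
  rw [translations, SemidirectProduct.range_inl_eq_ker_rightHom]
  infer_instance

/-- The set of all stabilizers in `𝔽⁺ ⋊ 𝔽ˣ` of points of `𝔽`. -/
def pointStabilizers (F : Type w) [Field F] : Set (Subgroup (AffineGroup F)) :=
  Set.range (fun x : F => MulAction.stabilizer (AffineGroup F) x)

/-! ### The incidence matrix -/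

/-- An orientation of `G`: a choice of tail and head for every edge. -/
structure Orientation (G : Graph V E) where
  tail : G.edgeSet → V
  head : G.edgeSet → V
  isLink : ∀ e : G.edgeSet, G.IsLink e (tail e) (head e)

open Classical in
/-- The incidence matrix `A(D, ψ)`; the extra row `v₀` is `none`. -/
noncomputable def incidenceMatrix {G : Graph V E} {F : Type w} [Field F] (D : Orientation G)
    (ψ : GainFunction G (AffineGroup F)) : Matrix (Option G.vertexSet) G.edgeSet F :=
  fun r e =>
    match r with
    | none => AffineGroup.trans (ψ.gain e (D.tail e) (D.head e))
    | some u =>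
      if (u : V) = D.tail e ∧ (u : V) ≠ D.head e then 1
      else if (u : V) = D.head e ∧ (u : V) ≠ D.tail e then
        -AffineGroup.scale (ψ.gain e (D.tail e) (D.head e))
      else if (u : V) = D.tail e ∧ (u : V) = D.head e then
        1 - AffineGroup.scale (ψ.gain e (D.tail e) (D.head e))
      else 0

end GainGraph

namespace GainGraph

/-! ### Vector matroids -/

section LinearMatroid

variable {F : Type*} [Field F] {E : Type*} {W : Type*} [AddCommGroup W] [Module F W]

/-! Write δ_v for the unit vector of a vertex v. The column of an edge e from v to w with gain (a,
b) splits into a frame part φ(e) = δ_v − b δ_w and the entry α(e) = a in the row v₀. Three facts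
about this splitting give the theorem.

The vectors φ(e) represent F(G, ψ/𝔽⁺), so this frame matroid exists
(`isFrameMatroid_linearMatroid`). The columns along a walk telescope to δ_x − b δ_y, where b is the
gain of the walk. Hence a balanced cycle is dependent, while the span of an unbalanced cycle
contains δ_x for each of its vertices x; this makes every frame circuit a circuit. Conversely,
linear functionals built from walk gains show that every dependent set contains a frame circuit.

Appending one coordinate α to a vector configuration produces an elementary lift, whose linear class
consists of the circuits that stay dependent (`linearMatroid_isLiftOf`). A circuit C stays dependent
exactly if α = f ∘ φ on C for some linear functional f (`linearMatroid_lift_not_indep_iff`).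

A functional f amounts to the function g(v) = f(δ_v), and f(φ(e)) = α(e) reads g(v) = a + b g(w),
that is, g(v) = ψ(e, v, w) · g(w). So the circuits that stay dependent are those carrying a
potential with values in the affine line, and these form 𝒞 (`mem_circuitClass_iff`). On a cycle
balanced modulo 𝔽⁺ the gain is a translation, which has a fixed point only if it is the identity. On
a handcuff or theta graph, switching by the translations by g(v) moves all gains into the stabilizer
of 0; conversely, if η moves them into the stabilizer of z, then v ↦ η(v) · z is a potential. -/

theorem finrank_span_image_eq_ncard {φ : E → W} {I : Set E} (hfin : I.Finite)
    (hI : LinearIndepOn F φ I) : Module.finrank F (Submodule.span F (φ '' I)) = I.ncard := by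
  have := hfin.fintype
  rw [Set.image_eq_range, finrank_span_eq_card hI, ← Nat.card_coe_set_eq, Nat.card_eq_fintype_card]

variable (F) in
/-- The vector matroid on the finite set `S` of the family of vectors `φ`. -/
noncomputable def linearMatroid (φ : E → W) {S : Set E} (hS : S.Finite) : Matroid E :=
  (IndepMatroid.ofFinite hS (fun I => I ⊆ S ∧ LinearIndepOn F φ I)
    ⟨Set.empty_subset _, linearIndepOn_empty F φ⟩
    (fun _ _ hJ hIJ => ⟨hIJ.trans hJ.1, hJ.2.mono hIJ⟩)
    (by
      intro I J hI hJ hlt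
      by_contra! hcon
      -- If no element of `J` extends `I`, the span of `J` lies in that of `I`, against the
      -- comparison of dimensions.
      have hsub : Submodule.span F (φ '' J) ≤ Submodule.span F (φ '' I) := by
        rw [Submodule.span_le]
        rintro _ ⟨e, he, rfl⟩
        by_cases heI : e ∈ I
        · exact Submodule.subset_span ⟨e, heI, rfl⟩
        · by_contra hes
          exact hcon e he heI (Set.insert_subset (hJ.1 he) hI.1)
            ((linearIndepOn_insert heI).2 ⟨hI.2, hes⟩)
      have hfI := hS.subset hI.1
      have : FiniteDimensional F (Submodule.span F (φ '' I)) :=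
        FiniteDimensional.span_of_finite F (hfI.image φ)
      have := Submodule.finrank_mono hsub
      rw [finrank_span_image_eq_ncard hfI hI.2,
        finrank_span_image_eq_ncard (hS.subset hJ.1) hJ.2] at this
      omega)
    (fun _ hI => hI.1)).matroid

variable {φ : E → W} {S : Set E} {hS : S.Finite}

@[simp]
theorem linearMatroid_ground : (linearMatroid F φ hS).E = S := rfl

theorem linearMatroid_indep_iff {I : Set E} :
    (linearMatroid F φ hS).Indep I ↔ I ⊆ S ∧ LinearIndepOn F φ I := Iff.rfl

theorem linearMatroid_dep_iff {X : Set E} (hX : X ⊆ S) :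
    (linearMatroid F φ hS).Dep X ↔ ¬ LinearIndepOn F φ X := by
  rw [Matroid.dep_iff, linearMatroid_indep_iff, linearMatroid_ground]
  tauto

instance linearMatroid_finite : (linearMatroid F φ hS).Finite := ⟨hS⟩

/-- For independent `X` this is the criterion for inserting one vector. In general `X` is replaced
by a basis: it has the same closure, and the same span because `X` lies in that closure. -/
theorem linearMatroid_mem_closure_iff {X : Set E} (hX : X ⊆ S) {e : E} (he : e ∈ S) :
    e ∈ (linearMatroid F φ hS).closure X ↔ φ e ∈ Submodule.span F (φ '' X) := by
  have key : ∀ (I : Set E), (linearMatroid F φ hS).Indep I → ∀ f ∈ S,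
      (f ∈ (linearMatroid F φ hS).closure I ↔ φ f ∈ Submodule.span F (φ '' I)) := by
    intro I hI f hf
    by_cases hfI : f ∈ I
    · exact iff_of_true (Matroid.mem_closure_of_mem _ hfI hI.subset_ground)
        (Submodule.subset_span ⟨f, hfI, rfl⟩)
    rw [hI.mem_closure_iff_of_notMem hfI, linearMatroid_dep_iff
      (Set.insert_subset hf hI.subset_ground), linearIndepOn_insert hfI]
    have := hI.2
    tauto
  obtain ⟨I, hI⟩ := (linearMatroid F φ hS).exists_isBasis X hX
  rw [← hI.closure_eq_closure, key I hI.indep e he]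
  suffices Submodule.span F (φ '' I) = Submodule.span F (φ '' X) by rw [this]
  refine le_antisymm (Submodule.span_mono (Set.image_mono hI.subset)) ?_
  rw [Submodule.span_le]
  rintro _ ⟨f, hf, rfl⟩
  exact (key I hI.indep f (hX hf)).1 (hI.subset_closure hf)

/-- A set with a one-element deletion that is independent, each of whose elements is spanned by the
others, is a circuit. -/
theorem isCircuit_of_indep_sdiff_of_forall_mem_closure {M : Matroid E} {C : Set E}
    (hfin : C.Finite) {e : E} (he : e ∈ C) (hI : M.Indep (C \ {e}))
    (hcl : ∀ f ∈ C, f ∈ M.closure (C \ {f})) : M.IsCircuit C := by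
  have hCE : C ⊆ M.E := fun f hf => M.closure_subset_ground _ (hcl f hf)
  -- All one-element deletions have the same rank and the same size, so independence of one passes
  -- to all.
  have hr : ∀ f ∈ C, M.eRk (C \ {f}) = M.eRk C := by
    intro f hf
    rw [← M.eRk_closure_eq, ← Matroid.closure_insert_eq_of_mem_closure (hcl f hf), M.eRk_closure_eq,
      Set.insert_sdiff_singleton, Set.insert_eq_of_mem hf]
  have hcard : ∀ f ∈ C, (C \ {f}).encard = (C \ {e}).encard := fun f hf => by
    rw [Set.encard_sdiff_singleton_of_mem hf, Set.encard_sdiff_singleton_of_mem he]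
  rw [Matroid.isCircuit_iff_dep_forall_sdiff_singleton_indep]
  refine ⟨?_, fun f hf => ?_⟩
  · have := (hI.mem_closure_iff_of_notMem (fun h => h.2 rfl)).1 (hcl e he)
    rwa [Set.insert_sdiff_singleton, Set.insert_eq_of_mem he] at this
  · rw [Matroid.indep_iff_eRk_eq_encard_of_finite (hfin.subset Set.sdiff_subset), hr f hf,
      ← hr e he, hcard f hf, hI.eRk_eq_encard]

theorem linearMatroid_isCircuit_of {C : Set E} (hC : C ⊆ S) {e : E} (he : e ∈ C)
    (hI : LinearIndepOn F φ (C \ {e}))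
    (hcl : ∀ f ∈ C, φ f ∈ Submodule.span F (φ '' (C \ {f}))) :
    (linearMatroid F φ hS).IsCircuit C :=
  isCircuit_of_indep_sdiff_of_forall_mem_closure (hS.subset hC) he
    ⟨Set.sdiff_subset.trans hC, hI⟩ fun f hf =>
      (linearMatroid_mem_closure_iff (Set.sdiff_subset.trans hC) (hC hf)).2 (hcl f hf)

theorem exists_mem_span_of_not_linearIndepOn {X : Set E} (h : ¬ LinearIndepOn F φ X) :
    ∃ e ∈ X, φ e ∈ Submodule.span F (φ '' (X \ {e})) := by
  rw [linearIndepOn_iff_notMem_span] at h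
  push Not at h
  exact h

/-! ### Elementary lifts of vector matroids -/

/-- An independent set stays independent when a coordinate is added. -/
theorem linearMatroid_indep_of_fst {α : E → F} {I : Set E} (h : (linearMatroid F φ hS).Indep I) :
    (linearMatroid F (fun e => (φ e, α e)) hS).Indep I :=
  ⟨h.1, LinearIndependent.of_comp (LinearMap.fst F W F) h.2⟩

/-- A set `I` that is independent after the lift carries, up to scalars, at most one linear relation
among its vectors `φ`: two of them could be combined to a relation that also annihilates `α`. So
removing one element of a circuit inside `I` restores independence. -/
theorem linearMatroid_lift_eRk_le {α : E → F} {X : Set E} (hX : X ⊆ S) :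
    (linearMatroid F (fun e => (φ e, α e)) hS).eRk X ≤ (linearMatroid F φ hS).eRk X + 1 := by
  rw [Matroid.eRk_le_iff]
  intro I hIX hI
  by_cases hd : (linearMatroid F φ hS).Indep I
  · exact (hd.encard_le_eRk_of_subset hIX).trans le_self_add
  rw [Matroid.not_indep_iff (hIX.trans hX)] at hd
  obtain ⟨C, hCI, hC⟩ := hd.exists_isCircuit_subset
  obtain ⟨e, he⟩ := hC.nonempty
  have hI' : (linearMatroid F φ hS).Indep (I \ {e}) := by
    by_contra hd'
    rw [Matroid.not_indep_iff ((Set.sdiff_subset.trans hIX).trans hX)] at hd'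
    obtain ⟨C', hC'I, hC'⟩ := hd'.exists_isCircuit_subset
    have rel : ∀ D ⊆ I, (linearMatroid F φ hS).IsCircuit D →
        ∃ c : E →₀ F, (c.support : Set E) ⊆ D ∧ c ≠ 0 ∧ Finsupp.linearCombination F φ c = 0 := by
      intro D hDI hD
      have := (linearMatroid_dep_iff hD.subset_ground).1 hD.dep
      rw [linearIndepOn_iff] at this
      push Not at this
      obtain ⟨c, hc, h0, hne⟩ := this
      exact ⟨c, (Finsupp.mem_supported F c).1 hc, hne, h0⟩
    obtain ⟨c', hc', hne', h0'⟩ := rel C' (hC'I.trans Set.sdiff_subset) hC'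
    obtain ⟨c, hc, hne, h0⟩ := rel C hCI hC
    have hce : c e ≠ 0 := by
      intro hce
      refine hne (linearIndepOn_iff.1 (hC.sdiff_singleton_indep he).2 c ?_ h0)
      rw [Finsupp.mem_supported]
      intro f hf
      refine ⟨hc hf, ?_⟩
      rintro rfl
      exact (Finsupp.mem_support_iff.1 hf) hce
    have hc'e : c' e = 0 := by
      by_contra h
      exact (hC'I (hc' (Finsupp.mem_support_iff.2 h))).2 rfl
    have hlift : ∀ d : E →₀ F, Finsupp.linearCombination F (fun e => (φ e, α e)) d =
        (Finsupp.linearCombination F φ d, Finsupp.linearCombination F α d) := by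
      intro d
      refine Prod.ext ?_ ?_
      · simp [Finsupp.linearCombination_apply, Finsupp.sum, Prod.fst_sum]
      · simp [Finsupp.linearCombination_apply, Finsupp.sum, Prod.snd_sum]
    have hindep := linearIndepOn_iff.1 hI.2
    have hsupp : ∀ d : E →₀ F, (d.support : Set E) ⊆ I → d ∈ Finsupp.supported F F I :=
      fun d hd => (Finsupp.mem_supported F d).2 hd
    -- The combination is chosen to kill the `α` coordinate. At `e` only `c` has a nonzero
    -- coefficient, so the coefficient there forces the `α`-value of `c'` to vanish, and then `c'`
    -- is itself a relation of the lifted vectors.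
    have hz := hindep (Finsupp.linearCombination F α c' • c - Finsupp.linearCombination F α c • c')
      (Submodule.sub_mem _ (Submodule.smul_mem _ _ (hsupp c (hc.trans hCI)))
        (Submodule.smul_mem _ _ (hsupp c' (hc'.trans (hC'I.trans Set.sdiff_subset)))))
      (by
        rw [hlift]
        simp only [map_sub, map_smul, h0, h0', smul_zero, sub_zero, smul_eq_mul, Prod.mk_eq_zero,
          true_and]
        ring)
    have hα' : Finsupp.linearCombination F α c' = 0 := by
      have := DFunLike.congr_fun hz e
      simpa [hc'e, hce] using this
    refine hne' (hindep c' (hsupp c' (hc'.trans (hC'I.trans Set.sdiff_subset))) ?_)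
    rw [hlift, h0', hα']
    rfl
  have h1 := hI'.encard_le_eRk_of_subset (Set.sdiff_subset.trans hIX)
  rw [← Set.encard_sdiff_singleton_add_one (hCI he)]
  gcongr

theorem linearMatroid_lift_isCircuit_of_not_indep {α : E → F} {C : Set E}
    (hC : (linearMatroid F φ hS).IsCircuit C)
    (h : ¬ (linearMatroid F (fun e => (φ e, α e)) hS).Indep C) :
    (linearMatroid F (fun e => (φ e, α e)) hS).IsCircuit C := by
  rw [Matroid.isCircuit_iff_dep_forall_sdiff_singleton_indep]
  have hsub : C ⊆ (linearMatroid F (fun e => (φ e, α e)) hS).E := hC.subset_ground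
  exact ⟨(Matroid.not_indep_iff hsub).1 h,
    fun e he => linearMatroid_indep_of_fst (hC.sdiff_singleton_indep he)⟩

theorem _root_.LinearIndepOn.exists_linearMap_eq {I : Set E} (hI : LinearIndepOn F φ I)
    (α : E → F) : ∃ f : W →ₗ[F] F, ∀ i ∈ I, f (φ i) = α i := by
  let b := Module.Basis.span hI
  obtain ⟨f, hf⟩ := LinearMap.exists_extend (b.constr F (fun i => α i))
  refine ⟨f, fun i hi => ?_⟩
  have h1 := b.constr_basis F (fun i => α i) ⟨i, hi⟩
  have h2 : (b ⟨i, hi⟩ : W) = φ i :=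
    congrArg Subtype.val (Module.Basis.span_apply hI ⟨i, hi⟩)
  rw [← hf, LinearMap.comp_apply, Submodule.subtype_apply, h2] at h1
  exact h1

/-- The pairs indexed by `I` lie on the graph of `f`, which is a subspace and so contains their
span. -/
theorem apply_eq_of_mem_span {α : E → F} {f : W →ₗ[F] F} {I : Set E} (hf : ∀ i ∈ I, f (φ i) = α i)
    {e : E} (he : (φ e, α e) ∈ Submodule.span F ((fun e => (φ e, α e)) '' I)) :
    f (φ e) = α e := by
  have hle : Submodule.span F ((fun e => (φ e, α e)) '' I) ≤
      LinearMap.ker (f.comp (LinearMap.fst F W F) - LinearMap.snd F W F) := by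
    rw [Submodule.span_le]
    rintro _ ⟨j, hj, rfl⟩
    simp [hf j hj]
  have := hle he
  simpa [sub_eq_zero] using this

/-- A circuit stays dependent after adding the coordinate `α` if and only if `α` is, on the
circuit, a linear functional of the vectors. -/
theorem linearMatroid_lift_not_indep_iff {α : E → F} {C : Set E}
    (hC : (linearMatroid F φ hS).IsCircuit C) :
    ¬ (linearMatroid F (fun e => (φ e, α e)) hS).Indep C ↔
      ∃ f : W →ₗ[F] F, ∀ e ∈ C, f (φ e) = α e := by
  constructor
  · intro h
    have hC' := linearMatroid_lift_isCircuit_of_not_indep hC h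
    obtain ⟨e, he⟩ := hC.nonempty
    have hI := (hC.sdiff_singleton_indep he).2
    have hmem := (linearMatroid_mem_closure_iff (Set.sdiff_subset.trans hC.subset_ground)
      (hC.subset_ground he)).1 (hC'.mem_closure_sdiff_singleton_of_mem he)
    -- The functional is interpolated on the independent set `C \ {e}`; the dependence in the lift
    -- forces the right value at `e`.
    obtain ⟨f, hf⟩ := hI.exists_linearMap_eq α
    refine ⟨f, fun i hi => ?_⟩
    by_cases hie : i = e
    · subst hie
      exact apply_eq_of_mem_span hf hmem
    · exact hf i ⟨hi, hie⟩
  · rintro ⟨f, hf⟩ hI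
    refine hC.not_indep ⟨hC.subset_ground, ?_⟩
    -- The graph embedding of `f` sends `φ` to the lifted vectors on `C`, so their independence
    -- would pull back to `φ`.
    let g : W →ₗ[F] W × F := LinearMap.prod LinearMap.id f
    refine LinearIndependent.of_comp g ?_
    refine (linearIndepOn_congr (v := fun e => (φ e, α e)) (w := g ∘ φ) ?_).1 hI.2
    intro e he
    simp [g, hf e he]

open Classical in
-- If all circuits inside `X` stay dependent, fundamental circuits show that a basis of `X` still
-- spans it after the lift. Otherwise a circuit `C` becomes independent. Extend `C \ {e}` to a basis
-- `J` of `X`: then `J` together with `e` is independent in the lift, since a dependence would make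
-- `α` a functional of `φ` on `C`.
theorem linearMatroid_lift_eRk {α : E → F} {X : Set E} (hX : X ⊆ S) :
    (linearMatroid F (fun e => (φ e, α e)) hS).eRk X =
      if ∀ C ⊆ X, (linearMatroid F φ hS).IsCircuit C →
        ¬ (linearMatroid F (fun e => (φ e, α e)) hS).Indep C
      then (linearMatroid F φ hS).eRk X else (linearMatroid F φ hS).eRk X + 1 := by
  obtain ⟨I, hI⟩ := (linearMatroid F φ hS).exists_isBasis X hX
  have hI' := linearMatroid_indep_of_fst (α := α) hI.indep
  split_ifs with h
  · rw [← hI.encard_eq_eRk, ← hI'.eRk_eq_encard]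
    refine (Matroid.IsBasis.eRk_eq_eRk (hI'.isBasis_of_subset_of_subset_closure hI.subset ?_)).symm
    intro e he
    by_cases heI : e ∈ I
    · exact Matroid.mem_closure_of_mem _ heI hI'.subset_ground
    have hC := hI.indep.fundCircuit_isCircuit (hI.subset_closure he) heI
    have hCsub := (linearMatroid F φ hS).fundCircuit_subset_insert e I
    have hC' := linearMatroid_lift_isCircuit_of_not_indep hC
      (h _ (hCsub.trans (Set.insert_subset he hI.subset)) hC)
    refine Matroid.closure_subset_closure _ ?_
      (hC'.mem_closure_sdiff_singleton_of_mem (Matroid.mem_fundCircuit _ e I))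
    rw [Set.sdiff_singleton_subset_iff]
    exact hCsub
  · refine le_antisymm (linearMatroid_lift_eRk_le hX) ?_
    push Not at h
    obtain ⟨C, hCX, hC, hCi⟩ := h
    obtain ⟨e, he⟩ := hC.nonempty
    obtain ⟨J, hJ, hCJ⟩ := (hC.sdiff_singleton_indep he).subset_isBasis_of_subset
      (Set.sdiff_subset.trans hCX) hX
    have heJ : e ∉ J := by
      intro heJ
      refine hC.not_indep (hJ.indep.subset ?_)
      intro f hf
      by_cases hfe : f = e
      · exact hfe ▸ heJ
      · exact hCJ ⟨hf, hfe⟩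
    rw [← hJ.encard_eq_eRk, ← Set.encard_insert_of_notMem heJ]
    refine Matroid.Indep.encard_le_eRk_of_subset ?_ (Set.insert_subset (hCX he) hJ.subset)
    refine ⟨Set.insert_subset (hX (hCX he)) (hJ.subset.trans hX), (linearIndepOn_insert heJ).2
      ⟨(linearMatroid_indep_of_fst hJ.indep).2, fun hmem => ?_⟩⟩
    obtain ⟨f, hf⟩ := hJ.indep.2.exists_linearMap_eq α
    refine (linearMatroid_lift_not_indep_iff hC).2 ⟨f, fun i hi => ?_⟩ hCi
    by_cases hie : i = e
    · subst hie
      exact apply_eq_of_mem_span hf hmem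
    · exact hf i (hCJ ⟨hi, hie⟩)

/-- If some circuit inside the union became independent, the rank of the union would grow by one,
leaving nullity one in the lift. But the union contains two distinct circuits of the lift, which
need nullity at least two. -/
theorem linearMatroid_isLinearClass {α : E → F} :
    IsLinearClass (linearMatroid F φ hS) {C | (linearMatroid F φ hS).IsCircuit C ∧
      ¬ (linearMatroid F (fun e => (φ e, α e)) hS).Indep C} := by
  refine ⟨fun C hC => hC.1, ?_⟩
  intro C₁ hC₁ C₂ hC₂ hcard C hC hsub
  refine ⟨hC, fun hCi => ?_⟩
  have hU : C₁ ∪ C₂ ⊆ S := Set.union_subset hC₁.1.subset_ground hC₂.1.subset_ground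
  have hfin : (C₁ ∪ C₂).Finite := hS.subset hU
  set M := linearMatroid F (fun e => (φ e, α e)) hS with hM
  have hr := linearMatroid_lift_eRk (F := F) (φ := φ) (hS := hS) (α := α) hU
  rw [if_neg (by push Not; exact ⟨C, hsub, hC, hCi⟩)] at hr
  have hD₁ := linearMatroid_lift_isCircuit_of_not_indep hC₁.1 hC₁.2
  have hD₂ := linearMatroid_lift_isCircuit_of_not_indep hC₂.1 hC₂.2
  have hcard' : (C₁ ∪ C₂).encard = M.eRk (C₁ ∪ C₂) + 1 := by
    rw [hcard, hM, hr, add_assoc, one_add_one_eq_two]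
  -- A single circuit has nullity one, not two.
  have hne : C₁ ≠ C₂ := by
    rintro rfl
    rw [Set.union_self, ← hC₁.1.eRk_add_one_eq] at hcard
    have hfin' : (linearMatroid F φ hS).eRk C₁ ≠ ⊤ := by
      rw [Matroid.eRk_ne_top_iff]
      exact Matroid.isRkFinite_set _ _
    generalize (linearMatroid F φ hS).eRk C₁ = r at *
    lift r to ℕ using hfin'
    norm_cast at hcard
    omega
  obtain ⟨e, he₁, he₂⟩ : ∃ e ∈ C₁, e ∉ C₂ := by
    by_contra! h
    exact hne (hD₁.eq_of_subset_isCircuit hD₂ h)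
  -- Deleting `e` keeps the rank because of `C₁`, and what remains is still dependent because of
  -- `C₂`.
  have h1 : M.eRk ((C₁ ∪ C₂) \ {e}) = M.eRk (C₁ ∪ C₂) := by
    have := M.closure_subset_closure (Set.sdiff_subset_sdiff_left (t := {e})
      (Set.subset_union_left (s := C₁) (t := C₂))) (hD₁.mem_closure_sdiff_singleton_of_mem he₁)
    rw [← M.eRk_closure_eq, ← Matroid.closure_insert_eq_of_mem_closure this, M.eRk_closure_eq,
      Set.insert_sdiff_singleton, Set.insert_eq_of_mem (Set.mem_union_left _ he₁)]
  have hdep : M.Dep ((C₁ ∪ C₂) \ {e}) :=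
    hD₂.dep.superset (fun f hf => ⟨Or.inr hf, by rintro rfl; exact he₂ hf⟩)
      (Set.sdiff_subset.trans hU)
  have h2 := Matroid.eRk_lt_encard_of_dep_of_finite (hfin.subset Set.sdiff_subset) hdep
  rw [h1] at h2
  have h3 := Set.encard_sdiff_singleton_add_one (Set.mem_union_left C₂ he₁)
  rw [hcard'] at h3
  exact h2.ne (WithTop.add_right_cancel ENat.one_ne_top h3).symm

open Classical in
theorem linearMatroid_isLiftOf {α : E → F} :
    IsLiftOf (linearMatroid F φ hS) {C | (linearMatroid F φ hS).IsCircuit C ∧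
      ¬ (linearMatroid F (fun e => (φ e, α e)) hS).Indep C}
      (linearMatroid F (fun e => (φ e, α e)) hS) := by
  refine ⟨linearMatroid_isLinearClass, rfl, fun X hX => ?_⟩
  refine (linearMatroid_lift_eRk hX).trans (if_congr ?_ rfl rfl)
  refine forall_congr' fun C => forall_congr' fun _ => forall_congr' fun hC => ?_
  exact (and_iff_right hC).symm

end LinearMatroid

/-! ### Walks -/

section Walks

variable {V E : Type*} {G : Graph V E}

namespace Walk

/-- Concatenation of walks. -/
def append : {x y z : V} → Walk G x y → Walk G y z → Walk G x z
  | _, _, _, nil _, q => q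
  | _, _, _, cons e h p, q => cons e h (p.append q)

/-- The reverse of a walk. -/
def reverse : {x y : V} → Walk G x y → Walk G y x
  | _, _, nil hx => nil hx
  | _, _, cons e h p => p.reverse.append (cons e h.symm (nil h.left_mem))

variable {x y z : V}

@[simp]
theorem support_nil (hx : x ∈ G.vertexSet) : (nil hx : Walk G x x).support = [x] := rfl

@[simp]
theorem support_cons {e : E} (h : G.IsLink e x y) (p : Walk G y z) :
    (cons e h p).support = x :: p.support := rfl

@[simp]
theorem edges_nil (hx : x ∈ G.vertexSet) : (nil hx : Walk G x x).edges = [] := rfl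

@[simp]
theorem edges_cons {e : E} (h : G.IsLink e x y) (p : Walk G y z) :
    (cons e h p).edges = e :: p.edges := rfl

@[simp]
theorem mem_edgeSet {p : Walk G x y} {e : E} : e ∈ p.edgeSet ↔ e ∈ p.edges := Iff.rfl

@[simp]
theorem mem_vertices {p : Walk G x y} {a : V} : a ∈ p.vertices ↔ a ∈ p.support := Iff.rfl

@[simp]
theorem edgeSet_nil (hx : x ∈ G.vertexSet) : (nil hx : Walk G x x).edgeSet = ∅ := by
  ext; simp

@[simp]
theorem edgeSet_cons {e : E} (h : G.IsLink e x y) (p : Walk G y z) :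
    (cons e h p).edgeSet = insert e p.edgeSet := by
  ext; simp

theorem support_eq_cons (p : Walk G x y) : p.support = x :: p.support.tail := by
  cases p <;> rfl

@[simp]
theorem start_mem_support (p : Walk G x y) : x ∈ p.support := by
  rw [support_eq_cons]; simp

@[simp]
theorem end_mem_support (p : Walk G x y) : y ∈ p.support := by
  induction p with
  | nil => simp
  | cons e h p ih => simp [ih]

theorem end_mem_tail_support (p : Walk G x y) (hne : x ≠ y) : y ∈ p.support.tail := by
  have := p.end_mem_support
  rw [support_eq_cons, List.mem_cons] at this
  exact this.resolve_left hne.symm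

theorem edgeSet_subset (p : Walk G x y) : p.edgeSet ⊆ G.edgeSet := by
  induction p with
  | nil => simp
  | cons e h p ih => simpa [Set.insert_subset_iff] using ⟨h.edge_mem, ih⟩

@[simp]
theorem edges_append (p : Walk G x y) (q : Walk G y z) :
    (p.append q).edges = p.edges ++ q.edges := by
  induction p with
  | nil => rfl
  | cons e h p ih => simp [append, ih]

@[simp]
theorem edgeSet_append (p : Walk G x y) (q : Walk G y z) :
    (p.append q).edgeSet = p.edgeSet ∪ q.edgeSet := by
  ext; simp

theorem support_append (p : Walk G x y) (q : Walk G y z) :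
    (p.append q).support = p.support ++ q.support.tail := by
  induction p with
  | nil => exact q.support_eq_cons
  | cons e h p ih => simp [append, ih]

theorem mem_support_append {p : Walk G x y} {q : Walk G y z} {a : V} :
    a ∈ (p.append q).support ↔ a ∈ p.support ∨ a ∈ q.support := by
  rw [support_append, List.mem_append, q.support_eq_cons]
  simp only [List.tail_cons, List.mem_cons]
  constructor
  · tauto
  · rintro (h | rfl | h)
    · exact Or.inl h
    · exact Or.inl p.end_mem_support
    · exact Or.inr h

@[simp]
theorem edges_reverse (p : Walk G x y) : p.reverse.edges = p.edges.reverse := by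
  induction p with
  | nil => rfl
  | cons e h p ih => simp [reverse, ih]

@[simp]
theorem edgeSet_reverse (p : Walk G x y) : p.reverse.edgeSet = p.edgeSet := by
  ext; simp

@[simp]
theorem support_reverse (p : Walk G x y) : p.reverse.support = p.support.reverse := by
  induction p with
  | nil => rfl
  | cons e h p ih => simp [reverse, support_append, ih]

theorem vertices_reverse (p : Walk G x y) : p.reverse.vertices = p.vertices := by
  ext; simp

theorem IsPath.reverse {p : Walk G x y} (hp : p.IsPath) : p.reverse.IsPath := by
  simpa [IsPath] using hp

theorem mem_support_of_mem_edges {p : Walk G x y} {e : E} (he : e ∈ p.edges) {a : V}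
    (ha : G.Inc e a) : a ∈ p.support := by
  induction p with
  | nil => simp at he
  | cons f h p ih =>
    rw [edges_cons, List.mem_cons] at he
    rw [support_cons, List.mem_cons]
    obtain rfl | he := he
    · obtain ⟨b, hb⟩ := ha
      obtain rfl | rfl := hb.left_eq_or_eq h
      · exact Or.inl rfl
      · exact Or.inr p.start_mem_support
    · exact Or.inr (ih he)

theorem vertexSetOf_edgeSet_subset (p : Walk G x y) : vertexSetOf G p.edgeSet ⊆ p.vertices :=
  fun _ ⟨_, he, ha⟩ => mem_support_of_mem_edges he ha

theorem vertexSetOf_edgeSet (p : Walk G x y) (hne : p.edges ≠ []) :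
    vertexSetOf G p.edgeSet = p.vertices := by
  refine subset_antisymm p.vertexSetOf_edgeSet_subset ?_
  intro a ha
  induction p with
  | nil => simp at hne
  | cons e h p ih =>
    rw [mem_vertices, support_cons, List.mem_cons] at ha
    obtain rfl | ha := ha
    · exact ⟨e, by simp, _, h⟩
    · cases p with
      | nil =>
        rw [support_nil, List.mem_singleton] at ha
        exact ⟨e, by simp, _, ha ▸ h.symm⟩
      | cons f h' p =>
        obtain ⟨g, hg, hga⟩ := ih (by simp) ha
        exact ⟨g, by rw [edgeSet_cons]; exact Or.inr hg, hga⟩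

theorem isPath_nil (hx : x ∈ G.vertexSet) : (nil hx : Walk G x x).IsPath := by simp [IsPath]

@[simp]
theorem isPath_cons {e : E} {h : G.IsLink e x y} {p : Walk G y z} :
    (cons e h p).IsPath ↔ x ∉ p.support ∧ p.IsPath := by
  simp [IsPath]

theorem IsPath.edges_nodup {p : Walk G x y} (hp : p.IsPath) : p.edges.Nodup := by
  induction p with
  | nil => simp
  | cons e h p ih =>
    rw [isPath_cons] at hp
    rw [edges_cons, List.nodup_cons]
    exact ⟨fun he => hp.1 (mem_support_of_mem_edges he ⟨_, h⟩), ih hp.2⟩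

theorem IsPath.start_notMem_tail {p : Walk G x y} (hp : p.IsPath) : x ∉ p.support.tail := by
  rw [IsPath, support_eq_cons, List.nodup_cons] at hp
  exact hp.1

theorem IsPath.append {p : Walk G x y} {q : Walk G y z} (hp : p.IsPath) (hq : q.IsPath)
    (h : ∀ a ∈ p.support, a ∈ q.support → a = y) : (p.append q).IsPath := by
  rw [IsPath, support_append, List.nodup_append']
  refine ⟨hp, hq.tail, fun a ha ha' => ?_⟩
  obtain rfl := h a ha (List.mem_of_mem_tail ha')
  exact hq.start_notMem_tail ha'

theorem isPath_append_iff {p : Walk G x y} {q : Walk G y z} :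
    (p.append q).IsPath ↔ p.IsPath ∧ q.IsPath ∧ ∀ a ∈ p.support, a ∈ q.support → a = y := by
  refine ⟨fun h => ?_, fun h => h.1.append h.2.1 h.2.2⟩
  rw [IsPath, support_append, List.nodup_append'] at h
  have hdisj : ∀ a ∈ p.support, a ∉ q.support.tail := fun a ha ha' => h.2.2 ha ha'
  refine ⟨h.1, ?_, fun a ha ha' => ?_⟩
  · rw [IsPath, support_eq_cons, List.nodup_cons]
    exact ⟨hdisj _ p.end_mem_support, h.2.1⟩
  · rw [support_eq_cons, List.mem_cons] at ha'
    exact ha'.resolve_right (hdisj a ha)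

theorem IsPath.exists_eq_nil {p : Walk G x x} (hp : p.IsPath) : ∃ hx, p = nil hx := by
  cases p with
  | nil hx => exact ⟨hx, rfl⟩
  | cons e h p => exact absurd p.end_mem_support (isPath_cons.1 hp).1

/-- A walk can be split at each of its vertices. -/
theorem exists_eq_append {p : Walk G x y} {a : V} (ha : a ∈ p.support) :
    ∃ (q : Walk G x a) (r : Walk G a y), p = q.append r := by
  induction p with
  | nil hx =>
    rw [support_nil, List.mem_singleton] at ha
    subst ha
    exact ⟨nil hx, nil hx, rfl⟩
  | cons e h p ih =>
    rw [support_cons, List.mem_cons] at ha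
    obtain rfl | ha := ha
    · exact ⟨nil h.left_mem, cons e h p, rfl⟩
    · obtain ⟨q, r, rfl⟩ := ih ha
      exact ⟨cons e h q, r, rfl⟩

/-- A walk can be split at its first vertex in a set. -/
theorem exists_eq_append_first {p : Walk G x y} {S : Set V} (hS : ∃ a ∈ p.support, a ∈ S) :
    ∃ (a : V) (q : Walk G x a) (r : Walk G a y), p = q.append r ∧ a ∈ S ∧
      ∀ b ∈ q.support, b ∈ S → b = a := by
  induction p with
  | @nil x hx =>
    obtain ⟨a, ha, haS⟩ := hS
    rw [support_nil, List.mem_singleton] at ha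
    subst ha
    exact ⟨a, nil hx, nil hx, rfl, haS, by simp⟩
  | @cons x y z e h p ih =>
    by_cases hxS : x ∈ S
    · exact ⟨x, nil h.left_mem, cons e h p, rfl, hxS, by simp⟩
    · obtain ⟨a, q, r, rfl, haS, hq⟩ := ih (by
        obtain ⟨a, ha, haS⟩ := hS
        rw [support_cons, List.mem_cons] at ha
        obtain rfl | ha := ha
        · exact absurd haS hxS
        · exact ⟨a, ha, haS⟩)
      refine ⟨a, cons e h q, r, rfl, haS, fun b hb hbS => ?_⟩
      rw [support_cons, List.mem_cons] at hb
      obtain rfl | hb := hb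
      · exact absurd hbS hxS
      · exact hq b hb hbS

/-- A walk can be split at its last vertex in a set. -/
theorem exists_eq_append_last {p : Walk G x y} {S : Set V} (hS : ∃ a ∈ p.support, a ∈ S) :
    ∃ (a : V) (q : Walk G x a) (r : Walk G a y), p = q.append r ∧ a ∈ S ∧
      ∀ b ∈ r.support, b ∈ S → b = a := by
  induction p with
  | @nil x hx =>
    obtain ⟨a, ha, haS⟩ := hS
    rw [support_nil, List.mem_singleton] at ha
    subst ha
    exact ⟨a, nil hx, nil hx, rfl, haS, by simp⟩
  | @cons x y z e h p ih =>
    by_cases hp : ∃ a ∈ p.support, a ∈ S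
    · obtain ⟨a, q, r, rfl, haS, hr⟩ := ih hp
      exact ⟨a, cons e h q, r, rfl, haS, hr⟩
    · push Not at hp
      obtain ⟨a, ha, haS⟩ := hS
      rw [support_cons, List.mem_cons] at ha
      obtain rfl | ha := ha
      · refine ⟨a, nil h.left_mem, cons e h p, rfl, haS, fun b hb hbS => ?_⟩
        rw [support_cons, List.mem_cons] at hb
        exact hb.resolve_right fun hb => hp b hb hbS
      · exact absurd haS (hp a ha)

theorem exists_isPath (p : Walk G x y) :
    ∃ q : Walk G x y, q.IsPath ∧ q.edgeSet ⊆ p.edgeSet := by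
  induction p with
  | nil hx => exact ⟨nil hx, isPath_nil hx, subset_rfl⟩
  | @cons x y z e h p ih =>
    obtain ⟨q, hq, hqp⟩ := ih
    rw [edgeSet_cons]
    by_cases hx : x ∈ q.support
    · obtain ⟨q₁, q₂, rfl⟩ := exists_eq_append hx
      refine ⟨q₂, (isPath_append_iff.1 hq).2.1, ?_⟩
      rw [edgeSet_append] at hqp
      exact (Set.subset_union_right.trans hqp).trans (Set.subset_insert _ _)
    · refine ⟨cons e h q, isPath_cons.2 ⟨hx, hq⟩, ?_⟩
      rw [edgeSet_cons]
      exact Set.insert_subset_insert hqp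

/-! ### Simple closed walks -/

/-- Since `p` is a path, the condition on `e` excludes only the walk that goes along `e` and
straight back. -/
theorem isSimpleClosed_cons {e : E} {h : G.IsLink e x y} {p : Walk G y x} :
    (cons e h p).IsSimpleClosed ↔ e ∉ p.edges ∧ p.IsPath := by
  simp only [IsSimpleClosed, edges_cons, ne_eq, reduceCtorEq, not_false_eq_true, List.nodup_cons,
    support_cons, List.tail_cons, true_and]
  exact ⟨fun h => ⟨h.1.1, h.2⟩, fun h => ⟨⟨h.1, h.2.edges_nodup⟩, h.2⟩⟩

theorem IsSimpleClosed.exists_eq_cons {p : Walk G x x} (hp : p.IsSimpleClosed) :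
    ∃ (e : E) (y : V) (h : G.IsLink e x y) (q : Walk G y x), p = cons e h q ∧ e ∉ q.edges ∧
      q.IsPath := by
  cases p with
  | nil => exact absurd rfl hp.1
  | cons e h q => exact ⟨e, _, h, q, rfl, isSimpleClosed_cons.1 hp⟩

theorem IsSimpleClosed.vertexSetOf {p : Walk G x x} (hp : p.IsSimpleClosed) :
    vertexSetOf G p.edgeSet = p.vertices :=
  p.vertexSetOf_edgeSet hp.1

theorem IsSimpleClosed.isCycle {p : Walk G x x} (hp : p.IsSimpleClosed) : IsCycle G p.edgeSet :=
  ⟨x, p, hp, rfl⟩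

theorem tail_support_append (p : Walk G x y) (q : Walk G y z) :
    (p.append q).support.tail = p.support.tail ++ q.support.tail := by
  rw [support_append, p.support_eq_cons]
  rfl

/-- A simple closed walk can be started at each of its vertices. -/
theorem IsSimpleClosed.exists_rotate {p : Walk G x x} (hp : p.IsSimpleClosed) {a : V}
    (ha : a ∈ p.support) :
    ∃ q : Walk G a a, q.IsSimpleClosed ∧ q.edgeSet = p.edgeSet := by
  obtain ⟨q, r, rfl⟩ := exists_eq_append ha
  have hperm : ((r.append q).edges).Perm (q.append r).edges := by
    simpa using List.perm_append_comm
  refine ⟨r.append q, ⟨?_, hperm.nodup_iff.2 hp.2.1, ?_⟩, by simp [Set.union_comm]⟩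
  · intro h
    rw [h] at hperm
    exact hp.1 hperm.nil_eq.symm
  · have := hp.2.2
    rw [tail_support_append] at this ⊢
    exact List.perm_append_comm.nodup_iff.1 this

theorem _root_.GainGraph.IsCycle.exists_walk {C : Set E} (hC : IsCycle G C) {a : V}
    (ha : a ∈ GainGraph.vertexSetOf G C) :
    ∃ p : Walk G a a, p.IsSimpleClosed ∧ p.edgeSet = C := by
  obtain ⟨x, p, hp, rfl⟩ := hC
  rw [hp.vertexSetOf] at ha
  exact hp.exists_rotate ha

/-- Two distinct vertices of a simple closed walk split it into two paths. -/
theorem IsSimpleClosed.exists_isPath_isPath {c : Walk G x x} (hc : c.IsSimpleClosed) {a : V}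
    (ha : a ∈ c.support) (hne : x ≠ a) :
    ∃ p q : Walk G x a, p.IsPath ∧ q.IsPath ∧ Disjoint p.edgeSet q.edgeSet ∧
      p.vertices ∩ q.vertices = {x, a} ∧ c.edgeSet = p.edgeSet ∪ q.edgeSet := by
  obtain ⟨p, q, rfl⟩ := exists_eq_append ha
  obtain ⟨-, h1, h2⟩ := hc
  rw [tail_support_append, List.nodup_append'] at h2
  rw [edges_append, List.nodup_append'] at h1
  have hx := q.end_mem_tail_support hne.symm
  have hat := p.end_mem_tail_support hne
  have hdisj : ∀ b ∈ p.support.tail, b ∉ q.support.tail := fun b hb hb' => h2.2.2 hb hb'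
  have hq : q.IsPath := by
    rw [IsPath, support_eq_cons, List.nodup_cons]
    exact ⟨hdisj a hat, h2.2.1⟩
  refine ⟨p, q.reverse, ?_, hq.reverse, ?_, ?_, by simp⟩
  · rw [IsPath, support_eq_cons, List.nodup_cons]
    exact ⟨fun h => hdisj x h hx, h2.1⟩
  · rw [edgeSet_reverse, Set.disjoint_left]
    exact fun e he he' => h1.2.2 he he'
  · rw [vertices_reverse]
    ext b
    simp only [Set.mem_inter_iff, mem_vertices, Set.mem_insert_iff, Set.mem_singleton_iff]
    constructor
    · rintro ⟨hb, hb'⟩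
      rw [support_eq_cons, List.mem_cons] at hb hb'
      obtain hb | hb := hb
      · exact Or.inl hb
      obtain hb' | hb' := hb'
      · exact Or.inr hb'
      · exact absurd hb' (hdisj b hb)
    · rintro (rfl | rfl) <;> simp

/-- Two internally disjoint paths form a simple closed walk. -/
theorem IsPath.isSimpleClosed_append_reverse {p q : Walk G x y} (hne : x ≠ y) (hp : p.IsPath)
    (hq : q.IsPath) (hdisj : Disjoint p.edgeSet q.edgeSet)
    (hpq : p.vertices ∩ q.vertices = {x, y}) : (p.append q.reverse).IsSimpleClosed := by
  refine ⟨?_, ?_, ?_⟩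
  · cases p with
    | nil => exact absurd rfl hne
    | cons e h p => simp [Walk.append]
  · rw [edges_append, List.nodup_append']
    refine ⟨hp.edges_nodup, hq.reverse.edges_nodup, fun e he he' => ?_⟩
    rw [edges_reverse, List.mem_reverse] at he'
    exact Set.disjoint_left.1 hdisj he he'
  · rw [tail_support_append, List.nodup_append']
    refine ⟨hp.tail, hq.reverse.tail, fun a ha ha' => ?_⟩
    have h1 := List.mem_of_mem_tail ha'
    rw [support_reverse, List.mem_reverse] at h1
    have : a ∈ p.vertices ∩ q.vertices := ⟨List.mem_of_mem_tail ha, h1⟩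
    rw [hpq] at this
    obtain rfl | rfl := this
    · exact hp.start_notMem_tail ha
    · exact hq.reverse.start_notMem_tail ha'

end Walk

theorem vertexSetOf_union (X Y : Set E) :
    vertexSetOf G (X ∪ Y) = vertexSetOf G X ∪ vertexSetOf G Y := by
  ext a
  simp only [vertexSetOf, Set.mem_ofPred_eq, Set.mem_union]
  constructor
  · rintro ⟨e, he | he, h⟩
    exacts [Or.inl ⟨e, he, h⟩, Or.inr ⟨e, he, h⟩]
  · rintro (⟨e, he, h⟩ | ⟨e, he, h⟩)
    exacts [⟨e, Or.inl he, h⟩, ⟨e, Or.inr he, h⟩]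

theorem IsCycle.subset_edgeSet {C : Set E} (hC : IsCycle G C) : C ⊆ G.edgeSet := by
  obtain ⟨x, p, -, rfl⟩ := hC
  exact p.edgeSet_subset

end Walks

/-! ### Finding handcuffs and theta graphs -/

section TwoCycles

variable {V E : Type*} {G : Graph V E}

namespace Walk

theorem IsPath.exists_isLink_ne {x y : V} {p : Walk G x y} (hp : p.IsPath) {e : E}
    (he : e ∈ p.edges) : ∃ a b, G.IsLink e a b ∧ a ≠ b := by
  induction p with
  | nil => simp at he
  | cons f h p ih =>
    rw [isPath_cons] at hp
    rw [edges_cons, List.mem_cons] at he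
    obtain rfl | he := he
    · exact ⟨_, _, h, fun hxy => hp.1 (hxy ▸ p.start_mem_support)⟩
    · exact ih hp.2 he

/-- A path meeting the vertices of `X` at most once has no edge in `X`. -/
theorem IsPath.disjoint_edgeSet {x y a : V} {p : Walk G x y} (hp : p.IsPath) {X : Set E}
    (h : ∀ b ∈ p.support, b ∈ vertexSetOf G X → b = a) : Disjoint p.edgeSet X := by
  rw [Set.disjoint_left]
  intro e he heX
  obtain ⟨b, c, hbc, hne⟩ := hp.exists_isLink_ne he
  refine hne ((h b (mem_support_of_mem_edges he ⟨_, hbc⟩) ⟨e, heX, _, hbc⟩).trans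
    (h c (mem_support_of_mem_edges he ⟨_, hbc.symm⟩) ⟨e, heX, _, hbc.symm⟩).symm)

end Walk

open Walk

/-- Two vertex-disjoint cycles joined by a walk contain a loose handcuff. -/
theorem exists_isLooseHandcuff_subset {X C₁ C₂ : Set E} (h₁ : IsCycle G C₁) (h₂ : IsCycle G C₂)
    (hX₁ : C₁ ⊆ X) (hX₂ : C₂ ⊆ X) (hdisj : Disjoint (vertexSetOf G C₁) (vertexSetOf G C₂))
    {a b : V} (ha : a ∈ vertexSetOf G C₁) (hb : b ∈ vertexSetOf G C₂) (p : Walk G a b)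
    (hp : p.edgeSet ⊆ X) : ∃ C ⊆ X, IsLooseHandcuff G C := by
  obtain ⟨q, hq, hqp⟩ := p.exists_isPath
  -- The connecting path runs from the last vertex on `C₁` to the first vertex on `C₂` after it.
  obtain ⟨s, q₁, r, rfl, hs, hr⟩ := exists_eq_append_last (p := q) ⟨a, by simp, ha⟩
  obtain ⟨t, r₁, r₂, rfl, ht, hr₁⟩ := exists_eq_append_first (p := r) ⟨b, by simp, hb⟩
  have hpath := (isPath_append_iff.1 (isPath_append_iff.1 hq).2.1).1
  simp only [edgeSet_append, Set.union_subset_iff] at hqp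
  refine ⟨C₁ ∪ r₁.edgeSet ∪ C₂, Set.union_subset (Set.union_subset hX₁ (hqp.2.1.trans hp)) hX₂,
    C₁, C₂, h₁, h₂, hdisj, s, t, r₁, hpath, ?_, ?_, rfl⟩
  · ext c
    simp only [Set.mem_inter_iff, mem_vertices, Set.mem_singleton_iff]
    refine ⟨fun h => hr c (mem_support_append.2 (Or.inl h.1)) h.2, ?_⟩
    rintro rfl
    exact ⟨by simp, hs⟩
  · ext c
    simp only [Set.mem_inter_iff, mem_vertices, Set.mem_singleton_iff]
    refine ⟨fun h => hr₁ c h.1 h.2, ?_⟩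
    rintro rfl
    exact ⟨by simp, ht⟩

/-- Two cycles joined by a walk, one of which has an edge outside the other, contain a handcuff or
a theta graph. -/
theorem exists_isHandcuff_or_isTheta_subset {X : Set E} {u v a : V} {e : E} {h : G.IsLink e u v}
    {p : Walk G v u} {c : Walk G a a} (hp : (cons e h p).IsSimpleClosed) (hc : c.IsSimpleClosed)
    (hpX : (cons e h p).edgeSet ⊆ X) (hcX : c.edgeSet ⊆ X) (hec : e ∉ c.edgeSet)
    (w : Walk G u a) (hw : w.edgeSet ⊆ X) : ∃ C ⊆ X, IsHandcuff G C ∨ IsTheta G C := by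
  by_cases hdisj : Disjoint (vertexSetOf G (cons e h p).edgeSet) (vertexSetOf G c.edgeSet)
  · obtain ⟨C, hCX, hC⟩ := exists_isLooseHandcuff_subset hp.isCycle hc.isCycle hpX hcX hdisj
      (by rw [hp.vertexSetOf]; exact start_mem_support _)
      (by rw [hc.vertexSetOf]; exact start_mem_support _) w hw
    exact ⟨C, hCX, Or.inl (Or.inr hC)⟩
  have hpath := (isSimpleClosed_cons.1 hp).2
  have hvert : (cons e h p).vertices = p.vertices := by
    ext b
    simp only [mem_vertices, support_cons, List.mem_cons]
    refine ⟨?_, Or.inr⟩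
    rintro (rfl | hb)
    · simp
    · exact hb
  -- Let `s` and `t` be the first and last vertices of `p` on `c`. The segment `m` between them is
  -- discarded, and `p₂`, `e`, `p₁` form an ear from `t` to `s` that meets `c` only in its ends. If
  -- `s = t`, the two cycles form a tight handcuff; otherwise the ear and the two arcs of `c` form a
  -- theta graph.
  obtain ⟨s, p₁, r, rfl, hs, hp₁⟩ := exists_eq_append_first (p := p)
    (S := vertexSetOf G c.edgeSet) (by
      rw [Set.not_disjoint_iff] at hdisj
      obtain ⟨b, hb, hb'⟩ := hdisj
      rw [hp.vertexSetOf, hvert] at hb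
      exact ⟨b, hb, hb'⟩)
  obtain ⟨t, m, p₂, rfl, ht, hp₂⟩ := exists_eq_append_last (p := r) ⟨s, by simp, hs⟩
  obtain ⟨hpath₁, hpathr, hint₁⟩ := isPath_append_iff.1 hpath
  obtain ⟨hpathm, hpath₂, hint₂⟩ := isPath_append_iff.1 hpathr
  have hd₁ := hpath₁.disjoint_edgeSet hp₁
  have hd₂ := hpath₂.disjoint_edgeSet hp₂
  by_cases hst : s = t
  · subst hst
    obtain ⟨hs', rfl⟩ := hpathm.exists_eq_nil
    refine ⟨(cons e h (p₁.append ((nil hs').append p₂))).edgeSet ∪ c.edgeSet,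
      Set.union_subset hpX hcX, Or.inl (Or.inl ⟨_, _, hp.isCycle, hc.isCycle, ?_, ⟨s, ?_⟩, rfl⟩)⟩
    · rw [edgeSet_cons, edgeSet_append, edgeSet_append, edgeSet_nil, Set.empty_union]
      rw [Set.disjoint_insert_left, Set.disjoint_union_left]
      exact ⟨hec, hd₁, hd₂⟩
    · rw [hp.vertexSetOf, hvert]
      ext b
      simp only [Set.mem_inter_iff, mem_vertices, Set.mem_singleton_iff, mem_support_append,
        support_nil, List.mem_singleton]
      constructor
      · rintro ⟨hb | hb | hb, hbc⟩
        exacts [hp₁ b hb hbc, hb, hp₂ b hb hbc]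
      · rintro rfl
        exact ⟨Or.inr (Or.inl rfl), hs⟩
  · have hp₁₂ : ∀ b ∈ p₁.support, b ∉ p₂.support := by
      intro b hb hb'
      obtain rfl := hint₁ b hb (mem_support_append.2 (Or.inr hb'))
      exact hst (hint₂ b (by simp) hb')
    have hear : (p₂.append (cons e h p₁)).IsPath := by
      refine hpath₂.append (isPath_cons.2 ⟨fun hu => hp₁₂ u hu (by simp), hpath₁⟩)
        fun b hb hb' => ?_
      rw [support_cons, List.mem_cons] at hb'
      exact hb'.resolve_right fun hb' => hp₁₂ b hb' hb
    have hear_disj : Disjoint (p₂.append (cons e h p₁)).edgeSet c.edgeSet := by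
      rw [edgeSet_append, edgeSet_cons, Set.disjoint_union_left, Set.disjoint_insert_left]
      exact ⟨hd₂, hec, hd₁⟩
    have hear_vert : ∀ b ∈ (p₂.append (cons e h p₁)).support, b ∈ vertexSetOf G c.edgeSet →
        b = t ∨ b = s := by
      intro b hb hbc
      rw [mem_support_append, support_cons, List.mem_cons] at hb
      obtain hb | rfl | hb := hb
      · exact Or.inl (hp₂ b hb hbc)
      · exact Or.inl (hp₂ b (by simp) hbc)
      · exact Or.inr (hp₁ b hb hbc)
    have htc : t ∈ c.support := by rwa [hc.vertexSetOf] at ht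
    obtain ⟨c', hc', hcc'⟩ := hc.exists_rotate htc
    have hsc' : s ∈ c'.support := by rwa [← hcc', hc'.vertexSetOf] at hs
    obtain ⟨A, B, hA, hB, hAB, hABv, hcAB⟩ := hc'.exists_isPath_isPath hsc' (Ne.symm hst)
    have hsub : ∀ {Z : Walk G t s}, Z.edgeSet ⊆ c.edgeSet →
        Disjoint (p₂.append (cons e h p₁)).edgeSet Z.edgeSet ∧
        (p₂.append (cons e h p₁)).vertices ∩ Z.vertices = {t, s} := by
      intro Z hZ
      refine ⟨hear_disj.mono_right hZ, ?_⟩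
      have hne : Z.edges ≠ [] := by
        intro hnil
        cases Z with
        | nil => exact hst rfl
        | cons => simp at hnil
      ext b
      simp only [Set.mem_inter_iff, mem_vertices, Set.mem_insert_iff, Set.mem_singleton_iff]
      constructor
      · rintro ⟨hb, hb'⟩
        have : b ∈ vertexSetOf G Z.edgeSet := by rwa [Z.vertexSetOf_edgeSet hne]
        obtain ⟨f, hf, hfb⟩ := this
        exact hear_vert b hb ⟨f, hZ hf, hfb⟩
      · rintro (rfl | rfl) <;> simp
    have hAc : A.edgeSet ⊆ c.edgeSet := by rw [← hcc', hcAB]; exact Set.subset_union_left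
    have hBc : B.edgeSet ⊆ c.edgeSet := by rw [← hcc', hcAB]; exact Set.subset_union_right
    refine ⟨_, ?_, Or.inr ⟨t, s, p₂.append (cons e h p₁), A, B, Ne.symm hst, hear, hA, hB,
      (hsub hAc).1, (hsub hBc).1, hAB, (hsub hAc).2, (hsub hBc).2, hABv, rfl⟩⟩
    refine Set.union_subset (Set.union_subset (subset_trans ?_ hpX) (hAc.trans hcX)) (hBc.trans hcX)
    simp only [edgeSet_append, edgeSet_cons]
    intro f
    simp only [Set.mem_union, Set.mem_insert_iff]
    tauto

end TwoCycles

/-! ### Gains of walks -/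

section Gains

variable {V E : Type*} {G : Graph V E} {Γ : Type*} [Group Γ] (ψ : GainFunction G Γ)

open Walk

@[simp]
theorem GainFunction.walkGain_nil {x : V} (hx : x ∈ G.vertexSet) :
    ψ.walkGain (Walk.nil hx : Walk G x x) = 1 := rfl

@[simp]
theorem GainFunction.walkGain_cons {x y z : V} {e : E} (h : G.IsLink e x y) (p : Walk G y z) :
    ψ.walkGain (Walk.cons e h p) = ψ.gain e x y * ψ.walkGain p := rfl

@[simp]
theorem GainFunction.walkGain_append {x y z : V} (p : Walk G x y) (q : Walk G y z) :
    ψ.walkGain (p.append q) = ψ.walkGain p * ψ.walkGain q := by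
  induction p with
  | nil => simp [Walk.append]
  | cons e h p ih => simp [Walk.append, ih, mul_assoc]

theorem GainFunction.walkGain_quotient (Γ₁ : Subgroup Γ) [Γ₁.Normal] {x y : V} (p : Walk G x y) :
    (ψ.quotient Γ₁).walkGain p = (ψ.walkGain p : Γ ⧸ Γ₁) := by
  induction p with
  | nil => rfl
  | cons e h p ih =>
    rw [walkGain_cons, ih, walkGain_cons, QuotientGroup.mk_mul]
    rfl

/-- A walk leads to a simple closed walk of non-identity gain, or it can be shortened to a path
of the same gain. -/
theorem GainFunction.exists_isSimpleClosed_or_exists_isPath {x y : V} (w : Walk G x y) :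
    (∃ (a : V) (p : Walk G x a) (c : Walk G a a), c.IsSimpleClosed ∧ ψ.walkGain c ≠ 1 ∧
      p.edgeSet ⊆ w.edgeSet ∧ c.edgeSet ⊆ w.edgeSet) ∨
    ∃ p : Walk G x y, p.IsPath ∧ p.edgeSet ⊆ w.edgeSet ∧ ψ.walkGain p = ψ.walkGain w := by
  induction w with
  | nil hx => exact Or.inr ⟨Walk.nil hx, isPath_nil hx, subset_rfl, rfl⟩
  | @cons x y z e h w ih =>
    rw [edgeSet_cons]
    obtain ⟨a, p, c, hc, hgain, hp, hcw⟩ | ⟨p, hp, hpw, hgain⟩ := ih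
    · exact Or.inl ⟨a, Walk.cons e h p, c, hc, hgain, by
        rw [edgeSet_cons]; exact Set.insert_subset_insert hp, hcw.trans (Set.subset_insert _ _)⟩
    by_cases hx : x ∈ p.support
    · obtain ⟨p₁, p₂, rfl⟩ := exists_eq_append hx
      obtain ⟨hp₁, hp₂, hint⟩ := isPath_append_iff.1 hp
      rw [edgeSet_append, Set.union_subset_iff] at hpw
      -- The path returns to `x`. A closed part of gain `1` can be cut off without changing the
      -- total gain; any other closed part is the required cycle.
      by_cases hg : ψ.walkGain (Walk.cons e h p₁) = 1
      · refine Or.inr ⟨p₂, hp₂, hpw.2.trans (Set.subset_insert _ _), ?_⟩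
        rw [walkGain_cons] at hg
        rw [walkGain_cons, ← hgain, walkGain_append, ← mul_assoc, hg, one_mul]
      · refine Or.inl ⟨x, Walk.nil h.left_mem, Walk.cons e h p₁, ?_, hg, by simp, ?_⟩
        -- The closed part could reuse `e` only by walking straight back along it, and then its gain
        -- would be `1`.
        · refine isSimpleClosed_cons.2 ⟨fun he => hg ?_, hp₁⟩
          cases p₁ with
          | nil => simp at he
          | @cons _ b _ f h' p₁ =>
            rw [edges_cons, List.mem_cons] at he
            rw [isPath_cons] at hp₁
            obtain rfl | he := he
            · obtain rfl := h'.right_unique h.symm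
              obtain ⟨_, rfl⟩ := hp₁.2.exists_eq_nil
              have hne : b ≠ y := by
                rintro rfl
                exact hp₁.1 (by simp)
              simp [ψ.gain_symm e b y h hne]
            · exact absurd (mem_support_of_mem_edges he ⟨_, h.symm⟩) hp₁.1
        · rw [edgeSet_cons]
          exact Set.insert_subset_insert hpw.1
    · exact Or.inr ⟨Walk.cons e h p, isPath_cons.2 ⟨hx, hp⟩, by
        rw [edgeSet_cons]; exact Set.insert_subset_insert hpw, by simp [hgain]⟩

theorem GainFunction.exists_isSimpleClosed_of_walkGain_ne_one {x : V} (w : Walk G x x)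
    (hw : ψ.walkGain w ≠ 1) : ∃ (a : V) (p : Walk G x a) (c : Walk G a a), c.IsSimpleClosed ∧
      ψ.walkGain c ≠ 1 ∧ p.edgeSet ⊆ w.edgeSet ∧ c.edgeSet ⊆ w.edgeSet := by
  obtain h | ⟨p, hp, -, hgain⟩ := ψ.exists_isSimpleClosed_or_exists_isPath w
  · exact h
  · obtain ⟨_, rfl⟩ := hp.exists_eq_nil
    exact absurd hgain.symm hw

/-! ### Potentials -/

variable {Ω : Type*} [MulAction Γ Ω]

/-- A potential on `X`: a labelling of the vertices by elements of a `Γ`-set that is compatible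
with the gains of the edges in `X`. -/
def GainFunction.IsPotential (X : Set E) (g : V → Ω) : Prop :=
  ∀ e ∈ X, ∀ a b, G.IsLink e a b → g a = ψ.gain e a b • g b

variable {ψ}

/-- One direction of an edge suffices: reversing a non-loop inverts its gain, and a loop has only
one gain value. -/
theorem GainFunction.gain_smul_eq_of_isLink {g : V → Ω} {e : E} {x y a b : V}
    (h : G.IsLink e x y) (hg : g x = ψ.gain e x y • g y) (hab : G.IsLink e a b) :
    g a = ψ.gain e a b • g b := by
  obtain ⟨rfl, rfl⟩ | ⟨rfl, rfl⟩ := hab.eq_and_eq_or_eq_and_eq h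
  · exact hg
  · by_cases hne : a = b
    · subst hne
      exact hg
    · rw [ψ.gain_symm e a b hab hne, hg, inv_smul_smul]

theorem GainFunction.IsPotential.eq_walkGain_smul {X : Set E} {g : V → Ω}
    (hg : ψ.IsPotential X g) {x y : V} (p : Walk G x y) (hp : p.edgeSet ⊆ X) :
    g x = ψ.walkGain p • g y := by
  induction p with
  | nil => simp
  | cons e h p ih =>
    rw [edgeSet_cons, Set.insert_subset_iff] at hp
    rw [hg e hp.1 _ _ h, ih hp.2, walkGain_cons, mul_smul]

variable (ψ) in
-- The value at the end is free, and each edge, read backwards, determines the value at one new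
-- vertex.
theorem GainFunction.exists_isPotential_of_isPath {x y : V} (p : Walk G x y) (hp : p.IsPath)
    [Nonempty Ω] : ∃ g : V → Ω, ψ.IsPotential p.edgeSet g := by
  classical
  induction p with
  | nil => exact ⟨fun _ => Classical.arbitrary Ω, by simp [IsPotential]⟩
  | @cons x y z e h p ih =>
    rw [isPath_cons] at hp
    obtain ⟨g, hg⟩ := ih hp.2
    have hne : ∀ b ∈ p.support, b ≠ x := by
      rintro b hb rfl
      exact hp.1 hb
    refine ⟨Function.update g x (ψ.gain e x y • g y), ?_⟩
    · intro f hf a b hab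
      rw [mem_edgeSet, edges_cons, List.mem_cons] at hf
      obtain rfl | hf := hf
      · refine gain_smul_eq_of_isLink h ?_ hab
        rw [Function.update_self, Function.update_of_ne (hne y (by simp))]
      · rw [Function.update_of_ne (hne a (mem_support_of_mem_edges hf ⟨_, hab⟩)),
          Function.update_of_ne (hne b (mem_support_of_mem_edges hf ⟨_, hab.symm⟩))]
        exact hg f hf a b hab

/-- Balanced cycles carry a potential. -/
theorem GainFunction.IsBalancedCycle.exists_isPotential {C : Set E} (hC : ψ.IsBalancedCycle C)
    [Nonempty Ω] : ∃ g : V → Ω, ψ.IsPotential C g := by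
  obtain ⟨x, c, hc, rfl, hgain⟩ := hC
  obtain ⟨e, y, h, p, rfl, he, hp⟩ := hc.exists_eq_cons
  obtain ⟨g, hg⟩ := ψ.exists_isPotential_of_isPath (Ω := Ω) p hp
  refine ⟨g, ?_⟩
  rw [edgeSet_cons]
  rintro f (rfl | hf) a b hab
  · refine gain_smul_eq_of_isLink h ?_ hab
    -- The closing edge imposes no new condition, because the gain around the cycle is `1`.
    rw [hg.eq_walkGain_smul p subset_rfl, smul_smul, ← walkGain_cons ψ h, hgain, one_smul]
  · exact hg f hf a b hab

end Gains

/-! ### The frame matroid of a gain graph over the multiplicative group of a field -/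

section Frame

variable {V E : Type*} {G : Graph V E} {F : Type*} [Field F] {Δ : Type*} [Group Δ]

open Walk

open Classical in
/-- The column of the edge `e` in the frame matrix of `χ`, where gains are read through `ρ`. -/
noncomputable def frameVector (D : Orientation G) (χ : GainFunction G Δ) (ρ : Δ →* Fˣ) (e : E) :
    V →₀ F :=
  if h : e ∈ G.edgeSet then Finsupp.single (D.tail ⟨e, h⟩) 1 -
    Finsupp.single (D.head ⟨e, h⟩) (ρ (χ.gain e (D.tail ⟨e, h⟩) (D.head ⟨e, h⟩)) : F)
  else 0

/-- The span of the columns of `X`. -/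
noncomputable def frameSpan (D : Orientation G) (χ : GainFunction G Δ) (ρ : Δ →* Fˣ) (X : Set E) :
    Submodule F (V →₀ F) :=
  Submodule.span F (frameVector D χ ρ '' X)

variable {D : Orientation G} {χ : GainFunction G Δ} {ρ : Δ →* Fˣ}

theorem frameSpan_mono {X Y : Set E} (h : X ⊆ Y) : frameSpan D χ ρ X ≤ frameSpan D χ ρ Y :=
  Submodule.span_mono (Set.image_mono h)

theorem frameVector_mem_frameSpan {X : Set E} {e : E} (he : e ∈ X) :
    frameVector D χ ρ e ∈ frameSpan D χ ρ X :=
  Submodule.subset_span ⟨e, he, rfl⟩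

/-- Reversing an edge only rescales its column by a nonzero factor, so the orientation does not
affect spans. -/
theorem exists_smul_frameVector_eq {e : E} {x y : V} (h : G.IsLink e x y) :
    ∃ u : F, u ≠ 0 ∧ u • frameVector D χ ρ e =
      Finsupp.single x 1 - Finsupp.single y (ρ (χ.gain e x y) : F) := by
  have hD := D.isLink ⟨e, h.edge_mem⟩
  rw [frameVector, dif_pos h.edge_mem]
  obtain ⟨hx, hy⟩ | ⟨hx, hy⟩ := hD.eq_and_eq_or_eq_and_eq h
  · exact ⟨1, one_ne_zero, by rw [hx, hy, one_smul]⟩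
  · by_cases hne : x = y
    · subst hne
      exact ⟨1, one_ne_zero, by rw [hx, hy, one_smul]⟩
    · refine ⟨-(ρ (χ.gain e x y) : F), neg_ne_zero.2 (Units.ne_zero _), ?_⟩
      rw [hx, hy, χ.gain_symm e x y h hne, smul_sub, Finsupp.smul_single, Finsupp.smul_single]
      simp only [map_inv, smul_eq_mul, mul_one, neg_mul, Units.inv_mul, Finsupp.single_neg]
      abel

/-- Telescoping: each column is weighted by the gain of the part of the walk before it. -/
theorem single_sub_single_mem_frameSpan {x y : V} (p : Walk G x y) {X : Set E}
    (hp : p.edgeSet ⊆ X) :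
    Finsupp.single x 1 - Finsupp.single y (ρ (χ.walkGain p) : F) ∈ frameSpan D χ ρ X := by
  induction p with
  | nil => simp
  | @cons x y z e h p ih =>
    rw [edgeSet_cons, Set.insert_subset_iff] at hp
    obtain ⟨u, -, hu⟩ := exists_smul_frameVector_eq (D := D) (χ := χ) (ρ := ρ) h
    have h1 := (frameSpan D χ ρ X).smul_mem u (frameVector_mem_frameSpan hp.1)
    rw [hu] at h1
    have h2 := (frameSpan D χ ρ X).smul_mem (ρ (χ.gain e x y) : F) (ih hp.2)
    have h3 := (frameSpan D χ ρ X).add_mem h1 h2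
    rw [smul_sub, Finsupp.smul_single, Finsupp.smul_single, smul_eq_mul, smul_eq_mul, mul_one,
      sub_add_sub_cancel] at h3
    simpa using h3

/-- In the telescoping sum an edge that is used only once has a nonzero coefficient, so it can be
solved for. -/
theorem exists_single_sub_single_sub_mem_frameSpan {x y : V} (p : Walk G x y) {e : E}
    (he : e ∈ p.edges) (hp : p.edges.Nodup) :
    ∃ u : F, u ≠ 0 ∧ Finsupp.single x 1 - Finsupp.single y (ρ (χ.walkGain p) : F) -
      u • frameVector D χ ρ e ∈ frameSpan D χ ρ (p.edgeSet \ {e}) := by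
  induction p with
  | nil => simp at he
  | @cons x y z f h p ih =>
    rw [edges_cons, List.nodup_cons] at hp
    rw [edges_cons, List.mem_cons] at he
    obtain ⟨u, hu0, hu⟩ := exists_smul_frameVector_eq (D := D) (χ := χ) (ρ := ρ) h
    by_cases hef : e = f
    · subst hef
      refine ⟨u, hu0, ?_⟩
      rw [hu]
      have h2 := (frameSpan D χ ρ ((Walk.cons e h p).edgeSet \ {e})).smul_mem
        (ρ (χ.gain e x y) : F) (single_sub_single_mem_frameSpan p (fun f hf =>
          ⟨by rw [edgeSet_cons]; exact Or.inr hf, by rintro rfl; exact hp.1 hf⟩))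
      rw [smul_sub, Finsupp.smul_single, Finsupp.smul_single, smul_eq_mul, smul_eq_mul,
        mul_one] at h2
      rw [GainFunction.walkGain_cons, map_mul, Units.val_mul]
      convert h2 using 1
      abel
    · obtain ⟨w, hw0, hw⟩ := ih (he.resolve_left hef) hp.2
      refine ⟨(ρ (χ.gain f x y) : F) * w, mul_ne_zero (Units.ne_zero _) hw0, ?_⟩
      have h1 := (frameSpan D χ ρ ((Walk.cons f h p).edgeSet \ {e})).smul_mem u
        (frameVector_mem_frameSpan ⟨by simp, fun h => hef h.symm⟩)
      rw [hu] at h1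
      have h2 := (frameSpan D χ ρ ((Walk.cons f h p).edgeSet \ {e})).smul_mem
        (ρ (χ.gain f x y) : F) (frameSpan_mono (Set.sdiff_subset_sdiff_left
          (by rw [edgeSet_cons]; exact Set.subset_insert _ _)) hw)
      have h3 := Submodule.add_mem _ h1 h2
      rw [smul_sub, smul_sub, Finsupp.smul_single, Finsupp.smul_single, smul_eq_mul, smul_eq_mul,
        mul_one, smul_smul] at h3
      rw [GainFunction.walkGain_cons, map_mul, Units.val_mul]
      convert h3 using 1
      abel

/-- An edge of a walk lies in the span of the other edges of `C` if the difference of the ends of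
the walk does. -/
theorem frameVector_mem_frameSpan_of_walk {x y : V} (p : Walk G x y) {C : Set E}
    (hpC : p.edgeSet ⊆ C) (hp : p.edges.Nodup) {e : E} (he : e ∈ p.edges)
    (h : Finsupp.single x 1 - Finsupp.single y (ρ (χ.walkGain p) : F) ∈
      frameSpan D χ ρ (C \ {e})) :
    frameVector D χ ρ e ∈ frameSpan D χ ρ (C \ {e}) := by
  obtain ⟨u, hu0, hu⟩ := exists_single_sub_single_sub_mem_frameSpan (D := D) (χ := χ) (ρ := ρ)
    p he hp
  have h1 := Submodule.sub_mem _ h (frameSpan_mono (Set.sdiff_subset_sdiff_left hpC) hu)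
  rw [sub_sub_cancel] at h1
  exact (Submodule.smul_mem_iff _ hu0).1 h1

theorem single_mem_frameSpan_smul {X : Set E} {x : V} (c : F)
    (h : Finsupp.single x 1 ∈ frameSpan D χ ρ X) : Finsupp.single x c ∈ frameSpan D χ ρ X := by
  have := (frameSpan D χ ρ X).smul_mem c h
  rwa [Finsupp.smul_single, smul_eq_mul, mul_one] at this

theorem single_mem_frameSpan_of_walk {x y : V} (p : Walk G x y) {X : Set E} (hp : p.edgeSet ⊆ X)
    (hy : Finsupp.single y 1 ∈ frameSpan D χ ρ X) : Finsupp.single x 1 ∈ frameSpan D χ ρ X := by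
  have h := Submodule.add_mem _ (single_sub_single_mem_frameSpan (D := D) (χ := χ) (ρ := ρ) p hp)
    (single_mem_frameSpan_smul (ρ (χ.walkGain p) : F) hy)
  rwa [sub_add_cancel] at h

/-- For a closed walk of gain b the telescoping sum is (1 − b) δ_x, and b ≠ 1 in the field because
`ρ` is injective. -/
theorem single_mem_frameSpan_of_walkGain_ne_one (hρ : Function.Injective ρ) {x : V}
    (p : Walk G x x) {X : Set E} (hp : p.edgeSet ⊆ X) (hgain : χ.walkGain p ≠ 1) :
    Finsupp.single x 1 ∈ frameSpan D χ ρ X := by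
  have h := single_sub_single_mem_frameSpan (D := D) (χ := χ) (ρ := ρ) p hp
  rw [← Finsupp.single_sub] at h
  have hne : (1 : F) - ρ (χ.walkGain p) ≠ 0 := by
    rw [sub_ne_zero]
    intro h
    exact hgain (hρ (by rw [map_one]; exact Units.ext h.symm))
  have := (frameSpan D χ ρ X).smul_mem (1 - (ρ (χ.walkGain p) : F))⁻¹ h
  rwa [Finsupp.smul_single, smul_eq_mul, inv_mul_cancel₀ hne] at this

theorem single_mem_frameSpan_of_isCycle (hρ : Function.Injective ρ) {C X : Set E}
    (hC : IsCycle G C) (hCX : C ⊆ X) (hunb : ¬ χ.IsBalancedCycle C) {a : V}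
    (ha : a ∈ vertexSetOf G C) : Finsupp.single a 1 ∈ frameSpan D χ ρ X := by
  obtain ⟨p, hp, rfl⟩ := hC.exists_walk ha
  exact single_mem_frameSpan_of_walkGain_ne_one hρ p hCX fun h => hunb ⟨a, p, hp, rfl, h⟩

/-! #### Independent sets of edges -/

theorem frameVector_apply_eq_zero {e : E} {x : V} (h : ¬ G.Inc e x) :
    frameVector D χ ρ e x = 0 := by
  by_cases he : e ∈ G.edgeSet
  · have hD := D.isLink ⟨e, he⟩
    have h1 : D.tail ⟨e, he⟩ ≠ x := by
      rintro rfl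
      exact h ⟨_, hD⟩
    have h2 : D.head ⟨e, he⟩ ≠ x := by
      rintro rfl
      exact h ⟨_, hD.symm⟩
    rw [frameVector, dif_pos he, Finsupp.sub_apply, Finsupp.single_eq_of_ne h1.symm,
      Finsupp.single_eq_of_ne h2.symm, sub_zero]
  · rw [frameVector, dif_neg he, Finsupp.zero_apply]

theorem apply_eq_zero_of_mem_frameSpan {X : Set E} {x : V} (hx : x ∉ vertexSetOf G X)
    {v : V →₀ F} (hv : v ∈ frameSpan D χ ρ X) : v x = 0 := by
  have hle : frameSpan D χ ρ X ≤ LinearMap.ker (Finsupp.lapply x : (V →₀ F) →ₗ[F] F) := by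
    rw [frameSpan, Submodule.span_le]
    rintro _ ⟨e, he, rfl⟩
    exact frameVector_apply_eq_zero fun hinc => hx ⟨e, he, hinc⟩
  exact hle hv

/-- The new column is nonzero in the row `x`, where all columns of `X` vanish. -/
theorem linearIndepOn_insert_of_isLink {X : Set E} (hX : LinearIndepOn F (frameVector D χ ρ) X)
    {e : E} {x y : V} (h : G.IsLink e x y) (hne : x ≠ y) (hx : x ∉ vertexSetOf G X) :
    LinearIndepOn F (frameVector D χ ρ) (insert e X) := by
  rw [linearIndepOn_insert fun he => hx ⟨e, he, y, h⟩]
  refine ⟨hX, fun hmem => ?_⟩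
  obtain ⟨u, hu0, hu⟩ := exists_smul_frameVector_eq (D := D) (χ := χ) (ρ := ρ) h
  have h1 := apply_eq_zero_of_mem_frameSpan (D := D) (χ := χ) (ρ := ρ) hx hmem
  have h2 := DFunLike.congr_fun hu x
  rw [Finsupp.smul_apply, h1, smul_zero, Finsupp.sub_apply, Finsupp.single_eq_same,
    Finsupp.single_eq_of_ne hne, sub_zero] at h2
  exact zero_ne_one h2

/-- Adding the edges of the path from `y` backwards, each brings in a vertex not met before. -/
theorem linearIndepOn_union_edgeSet {X : Set E} (hX : LinearIndepOn F (frameVector D χ ρ) X)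
    {x y : V} (p : Walk G x y) (hp : p.IsPath)
    (h : ∀ a ∈ p.support, a ∈ vertexSetOf G X → a = y) :
    LinearIndepOn F (frameVector D χ ρ) (X ∪ p.edgeSet) := by
  induction p with
  | nil => simpa using hX
  | @cons x y z e hl p ih =>
    rw [isPath_cons] at hp
    rw [edgeSet_cons, Set.union_insert]
    refine linearIndepOn_insert_of_isLink (ih hp.2 fun a ha => h a (by simp [ha])) hl ?_ ?_
    · rintro rfl
      exact hp.1 p.start_mem_support
    · rw [vertexSetOf_union]
      rintro (hx | hx)
      · have := h x (by simp) hx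
        subst this
        exact hp.1 p.end_mem_support
      · exact hp.1 (p.vertexSetOf_edgeSet_subset hx)

theorem linearIndepOn_edgeSet_of_isPath {x y : V} (p : Walk G x y) (hp : p.IsPath) :
    LinearIndepOn F (frameVector D χ ρ) p.edgeSet := by
  have := linearIndepOn_union_edgeSet (D := D) (χ := χ) (ρ := ρ) (linearIndepOn_empty F _) p hp
    (by rintro a - ⟨e, he, -⟩; exact absurd he (Set.notMem_empty e))
  rwa [Set.empty_union] at this

/-- Here `Δ` acts on itself by multiplication, and the potential, read in the field, is a row vector
orthogonal to the columns of `X` with no zero entry. -/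
theorem exists_linearMap_of_isPotential {X : Set E} {g : V → Δ} (hg : χ.IsPotential X g) :
    ∃ f : (V →₀ F) →ₗ[F] F, (∀ v ∈ frameSpan D χ ρ X, f v = 0) ∧
      ∀ a c, f (Finsupp.single a c) = c * ρ (g a) := by
  let f : (V →₀ F) →ₗ[F] F := Finsupp.linearCombination F fun a => (ρ (g a) : F)
  have hf : ∀ a c, f (Finsupp.single a c) = c * ρ (g a) := fun a c => by
    simp [f, Finsupp.linearCombination_single]
  refine ⟨f, fun v hv => ?_, hf⟩
  have hle : frameSpan D χ ρ X ≤ LinearMap.ker f := by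
    rw [frameSpan, Submodule.span_le]
    rintro _ ⟨e, he, rfl⟩
    rw [SetLike.mem_coe, LinearMap.mem_ker, frameVector]
    split_ifs with h
    · rw [map_sub, hf, hf, hg e he _ _ (D.isLink ⟨e, h⟩), smul_eq_mul, map_mul, Units.val_mul]
      ring
    · exact map_zero f
  exact hle hv

/-- Without its first edge the cycle is a path, and a potential on it gives a functional vanishing
on its columns. That functional vanishes on the column of the first edge only if the gain around the
cycle is `1`. -/
theorem linearIndepOn_of_isCycle (hρ : Function.Injective ρ) {C : Set E} (hC : IsCycle G C)
    (hunb : ¬ χ.IsBalancedCycle C) : LinearIndepOn F (frameVector D χ ρ) C := by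
  obtain ⟨x, c, hc, rfl⟩ := hC
  have hgain : χ.walkGain c ≠ 1 := fun h => hunb ⟨x, c, hc, rfl, h⟩
  obtain ⟨e, y, h, p, rfl, he, hp⟩ := hc.exists_eq_cons
  rw [edgeSet_cons, linearIndepOn_insert (mem_edgeSet.not.2 he)]
  refine ⟨linearIndepOn_edgeSet_of_isPath p hp, fun hmem => hgain ?_⟩
  obtain ⟨g, hg⟩ := χ.exists_isPotential_of_isPath (Ω := Δ) p hp
  obtain ⟨f, hf0, hf⟩ := exists_linearMap_of_isPotential (D := D) (ρ := ρ) hg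
  obtain ⟨u, hu0, hu⟩ := exists_smul_frameVector_eq (D := D) (χ := χ) (ρ := ρ) h
  have h1 := congrArg f hu
  rw [map_smul, hf0 _ hmem, smul_zero, map_sub, hf, hf, one_mul,
    hg.eq_walkGain_smul p subset_rfl, smul_eq_mul, map_mul, Units.val_mul, ← mul_assoc, eq_comm,
    sub_eq_zero] at h1
  have h2 : (ρ (χ.walkGain (Walk.cons e h p)) : F) = 1 := by
    rw [GainFunction.walkGain_cons, map_mul, Units.val_mul]
    exact (mul_eq_right₀ (Units.ne_zero _)).1 h1.symm
  exact hρ (by rw [map_one]; exact Units.ext h2)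

/-! #### Frame circuits are circuits -/

variable (hS : G.edgeSet.Finite)

theorem isCircuit_of_isBalancedCycle {C : Set E} (hC : χ.IsBalancedCycle C) :
    (linearMatroid F (frameVector D χ ρ) hS).IsCircuit C := by
  obtain ⟨x, c, hc, rfl, hgain⟩ := hC
  have hnodup := hc.2.1
  obtain ⟨e, y, h, p, rfl, he, hp⟩ := hc.exists_eq_cons
  refine linearMatroid_isCircuit_of (Walk.edgeSet_subset _) (e := e) (by simp) ?_ ?_
  · rw [edgeSet_cons, Set.insert_sdiff_self_of_notMem (mem_edgeSet.not.2 he)]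
    exact linearIndepOn_edgeSet_of_isPath p hp
  · intro f hf
    refine frameVector_mem_frameSpan_of_walk _ subset_rfl hnodup hf ?_
    rw [hgain, map_one, Units.val_one, sub_self]
    exact zero_mem _

/-- Two unbalanced cycles joined by a path, possibly of length `0`, form a circuit. -/
theorem isCircuit_of_two_cycles (hρ : Function.Injective ρ) {C₁ C₂ : Set E} (h₁ : IsCycle G C₁)
    (h₂ : IsCycle G C₂) (hu₁ : ¬ χ.IsBalancedCycle C₁) (hu₂ : ¬ χ.IsBalancedCycle C₂)
    (hdisj : Disjoint C₁ C₂) {x y : V} (p : Walk G x y) (hp : p.IsPath)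
    (hp₁ : p.vertices ∩ vertexSetOf G C₁ = {x}) (hp₂ : p.vertices ∩ vertexSetOf G C₂ = {y})
    (hv : vertexSetOf G C₁ ∩ vertexSetOf G C₂ ⊆ {y}) :
    (linearMatroid F (frameVector D χ ρ) hS).IsCircuit (C₁ ∪ p.edgeSet ∪ C₂) := by
  have hp₁' : ∀ a ∈ p.support, a ∈ vertexSetOf G C₁ → a = x := fun a ha ha' =>
    hp₁.subset ⟨ha, ha'⟩
  have hp₂' : ∀ a ∈ p.support, a ∈ vertexSetOf G C₂ → a = y := fun a ha ha' =>
    hp₂.subset ⟨ha, ha'⟩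
  have hx : x ∈ vertexSetOf G C₁ := (hp₁.superset rfl).2
  have hy : y ∈ vertexSetOf G C₂ := (hp₂.superset rfl).2
  have hd₁ := hp.disjoint_edgeSet hp₁'
  have hd₂ := hp.disjoint_edgeSet hp₂'
  obtain ⟨c, hc, hcC⟩ := h₂.exists_walk hy
  obtain ⟨d, hdc, hdC⟩ := h₁.exists_walk hx
  have hsub₁ : C₁ ⊆ C₁ ∪ p.edgeSet ∪ C₂ := fun f hf => Or.inl (Or.inl hf)
  have hsubp : p.edgeSet ⊆ C₁ ∪ p.edgeSet ∪ C₂ := fun f hf => Or.inl (Or.inr hf)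
  have hsub₂ : C₂ ⊆ C₁ ∪ p.edgeSet ∪ C₂ := fun f hf => Or.inr hf
  obtain ⟨e, z, h, q, rfl, he, hq⟩ := hc.exists_eq_cons
  have heC₂ : e ∈ C₂ := by rw [← hcC]; simp
  have hqC₂ : q.edgeSet ⊆ C₂ := by rw [← hcC, edgeSet_cons]; exact Set.subset_insert _ _
  refine linearMatroid_isCircuit_of ?_ (hsub₂ heC₂) ?_ ?_
  · exact Set.union_subset (Set.union_subset h₁.subset_edgeSet p.edgeSet_subset) h₂.subset_edgeSet
  -- Without `e` the set is built from the independent cycle `C₁` by attaching two paths, the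
  -- reverse of `p` at `x` and `q` at `y`.
  · have heq : (C₁ ∪ p.edgeSet ∪ C₂) \ {e} = C₁ ∪ p.reverse.edgeSet ∪ q.edgeSet := by
      ext f
      simp only [← hcC, edgeSet_cons, edgeSet_reverse, Set.mem_sdiff, Set.mem_union,
        Set.mem_insert_iff, Set.mem_singleton_iff]
      constructor
      · tauto
      · rintro ((hf | hf) | hf)
        · refine ⟨Or.inl (Or.inl hf), ?_⟩
          rintro rfl
          exact Set.disjoint_left.1 hdisj hf heC₂
        · refine ⟨Or.inl (Or.inr hf), ?_⟩
          rintro rfl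
          exact Set.disjoint_left.1 hd₂ hf heC₂
        · refine ⟨Or.inr (Or.inr hf), ?_⟩
          rintro rfl
          exact he hf
    rw [heq]
    refine linearIndepOn_union_edgeSet (linearIndepOn_union_edgeSet
      (linearIndepOn_of_isCycle hρ h₁ hu₁) p.reverse hp.reverse
        fun a ha => hp₁' a (by simpa using ha)) q hq fun a ha ha' => ?_
    have haC₂ : a ∈ vertexSetOf G C₂ := by
      rw [← hcC, hc.vertexSetOf, mem_vertices, support_cons]
      exact List.mem_cons_of_mem _ ha
    rw [vertexSetOf_union] at ha'
    obtain ha' | ha' := ha'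
    · exact hv ⟨ha', haC₂⟩
    · refine hp₂' a ?_ haC₂
      simpa using p.reverse.vertexSetOf_edgeSet_subset ha'
  -- An edge of a walk is spanned by the others once the unit vectors of both ends of the walk are.
  -- A cycle avoiding `f` supplies a unit vector, which is carried along `p` where necessary.
  · have key : ∀ {f : E} {a b : V} (w : Walk G a b), f ∈ w.edges → w.edges.Nodup →
        w.edgeSet ⊆ C₁ ∪ p.edgeSet ∪ C₂ →
        Finsupp.single a 1 ∈ frameSpan D χ ρ ((C₁ ∪ p.edgeSet ∪ C₂) \ {f}) →
        Finsupp.single b 1 ∈ frameSpan D χ ρ ((C₁ ∪ p.edgeSet ∪ C₂) \ {f}) →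
        frameVector D χ ρ f ∈ frameSpan D χ ρ ((C₁ ∪ p.edgeSet ∪ C₂) \ {f}) :=
      fun w hf hw hsub ha hb => frameVector_mem_frameSpan_of_walk w hsub hw hf
        (Submodule.sub_mem _ ha (single_mem_frameSpan_smul _ hb))
    have hmem : ∀ {Z : Set E} {f : E}, Z ⊆ C₁ ∪ p.edgeSet ∪ C₂ → f ∉ Z →
        Z ⊆ (C₁ ∪ p.edgeSet ∪ C₂) \ {f} := fun hZ hf g hg =>
      ⟨hZ hg, by rintro rfl; exact hf hg⟩
    rintro f ((hf | hf) | hf)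
    · have hyS := single_mem_frameSpan_of_isCycle (D := D) (ρ := ρ) hρ h₂
        (hmem hsub₂ (Set.disjoint_left.1 hdisj hf)) hu₂ hy
      have hxS := single_mem_frameSpan_of_walk p
        (hmem hsubp (Set.disjoint_right.1 hd₁ hf)) hyS
      exact key d (by rwa [← mem_edgeSet, hdC]) hdc.2.1 (by rwa [hdC]) hxS hxS
    · exact key p hf hp.edges_nodup hsubp
        (single_mem_frameSpan_of_isCycle hρ h₁ (hmem hsub₁ (Set.disjoint_left.1 hd₁ hf)) hu₁ hx)
        (single_mem_frameSpan_of_isCycle hρ h₂ (hmem hsub₂ (Set.disjoint_left.1 hd₂ hf)) hu₂ hy)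
    · have hxS := single_mem_frameSpan_of_isCycle (D := D) (ρ := ρ) hρ h₁
        (hmem hsub₁ (Set.disjoint_right.1 hdisj hf)) hu₁ hx
      have hyS := single_mem_frameSpan_of_walk p.reverse
        (by rw [edgeSet_reverse]; exact hmem hsubp (Set.disjoint_right.1 hd₂ hf)) hxS
      exact key _ (by rwa [← mem_edgeSet, hcC]) hc.2.1 (by rwa [hcC]) hyS hyS

theorem isCircuit_of_isHandcuff (hρ : Function.Injective ρ) {C : Set E} (hC : IsHandcuff G C)
    (hunb : ∀ C' ⊆ C, IsCycle G C' → ¬ χ.IsBalancedCycle C') :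
    (linearMatroid F (frameVector D χ ρ) hS).IsCircuit C := by
  obtain ⟨C₁, C₂, h₁, h₂, hdisj, ⟨x, hx⟩, rfl⟩ |
    ⟨C₁, C₂, h₁, h₂, hdisj, x, y, p, hp, hp₁, hp₂, rfl⟩ := hC
  · have hx₁ : x ∈ vertexSetOf G C₁ := (hx.superset rfl).1
    have hx₂ : x ∈ vertexSetOf G C₂ := (hx.superset rfl).2
    obtain ⟨e, he, hinc⟩ := hx₁
    obtain ⟨y, hl⟩ := hinc
    -- A tight handcuff is the case of a connecting path of length `0`.
    have := isCircuit_of_two_cycles (D := D) hS hρ h₁ h₂ (hunb C₁ Set.subset_union_left h₁)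
      (hunb C₂ Set.subset_union_right h₂) hdisj (Walk.nil hl.left_mem) (isPath_nil _)
      (by
        ext a
        simp only [Set.mem_inter_iff, mem_vertices, support_nil, List.mem_singleton,
          Set.mem_singleton_iff, and_iff_left_iff_imp]
        rintro rfl
        exact ⟨e, he, y, hl⟩)
      (by
        ext a
        simp only [Set.mem_inter_iff, mem_vertices, support_nil, List.mem_singleton,
          Set.mem_singleton_iff, and_iff_left_iff_imp]
        rintro rfl
        exact hx₂)
      hx.subset
    rwa [edgeSet_nil, Set.union_empty] at this
  · refine isCircuit_of_two_cycles hS hρ h₁ h₂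
      (hunb C₁ (fun f hf => Or.inl (Or.inl hf)) h₁) (hunb C₂ (fun f hf => Or.inr hf) h₂) ?_ p hp hp₁
      hp₂ (by rw [Set.disjoint_iff_inter_eq_empty.1 hdisj]; exact Set.empty_subset _)
    rw [Set.disjoint_left]
    intro f hf hf'
    obtain ⟨a, b, hab⟩ := G.exists_isLink_of_mem_edgeSet (h₁.subset_edgeSet hf)
    exact Set.disjoint_left.1 hdisj ⟨f, hf, b, hab⟩ ⟨f, hf', b, hab⟩

theorem isCircuit_of_isTheta (hρ : Function.Injective ρ) {C : Set E} (hC : IsTheta G C)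
    (hunb : ∀ C' ⊆ C, IsCycle G C' → ¬ χ.IsBalancedCycle C') :
    (linearMatroid F (frameVector D χ ρ) hS).IsCircuit C := by
  obtain ⟨x, y, p, q, r, hne, hp, hq, hr, hpq, hpr, hqr, hpqv, hprv, hqrv, rfl⟩ := hC
  set C := p.edgeSet ∪ q.edgeSet ∪ r.edgeSet with hCdef
  have hpC : p.edgeSet ⊆ C := fun f hf => Or.inl (Or.inl hf)
  have hqC : q.edgeSet ⊆ C := fun f hf => Or.inl (Or.inr hf)
  have hrC : r.edgeSet ⊆ C := fun f hf => Or.inr hf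
  -- The paths `b` and `c` form an unbalanced cycle avoiding `f`, whose span contains the unit
  -- vectors of both ends of `a`.
  have key : ∀ a b c : Walk G x y, a.IsPath → b.IsPath → c.IsPath → a.edgeSet ⊆ C →
      b.edgeSet ⊆ C → c.edgeSet ⊆ C → Disjoint a.edgeSet b.edgeSet → Disjoint a.edgeSet c.edgeSet →
      Disjoint b.edgeSet c.edgeSet → b.vertices ∩ c.vertices = {x, y} → ∀ f ∈ a.edgeSet,
      frameVector D χ ρ f ∈ frameSpan D χ ρ (C \ {f}) := by
    intro a b c ha hb hc haC hbC hcC hab hac hbc hbcv f hf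
    have hcyc := hb.isSimpleClosed_append_reverse hne hc hbc hbcv
    have hsubC : (b.append c.reverse).edgeSet ⊆ C := by
      rw [edgeSet_append, edgeSet_reverse]
      exact Set.union_subset hbC hcC
    have hsub : (b.append c.reverse).edgeSet ⊆ C \ {f} := by
      refine fun g hg => ⟨hsubC hg, ?_⟩
      rintro rfl
      rw [edgeSet_append, edgeSet_reverse] at hg
      exact hg.elim (Set.disjoint_left.1 hab hf) (Set.disjoint_left.1 hac hf)
    have hmem : ∀ v ∈ (b.append c.reverse).support,
        Finsupp.single v 1 ∈ frameSpan D χ ρ (C \ {f}) := fun v hv =>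
      single_mem_frameSpan_of_isCycle hρ hcyc.isCycle hsub (hunb _ hsubC hcyc.isCycle)
        (by rwa [hcyc.vertexSetOf])
    refine frameVector_mem_frameSpan_of_walk a haC ha.edges_nodup hf
      (Submodule.sub_mem _ (hmem x (by simp)) (single_mem_frameSpan_smul _ (hmem y ?_)))
    exact mem_support_append.2 (Or.inl (by simp))
  cases p with
  | nil => exact absurd rfl hne
  | @cons _ z _ e h p' =>
    have hep : e ∈ (Walk.cons e h p').edgeSet := by simp
    have hpe := hp.edges_nodup
    rw [edges_cons, List.nodup_cons] at hpe
    have hpath := isPath_cons.1 hp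
    refine linearMatroid_isCircuit_of ?_ (hpC hep) ?_ ?_
    · exact Set.union_subset (Set.union_subset (edgeSet_subset _) (edgeSet_subset _))
        (edgeSet_subset _)
    -- Without the first edge of `p` there remains the unbalanced cycle of `q` and `r` with the rest
    -- of `p` attached at `y`.
    · have heq : C \ {e} = (q.append r.reverse).edgeSet ∪ p'.edgeSet := by
        ext f
        simp only [hCdef, edgeSet_append, edgeSet_reverse, edgeSet_cons, Set.mem_sdiff,
          Set.mem_union, Set.mem_insert_iff, Set.mem_singleton_iff]
        constructor
        · tauto
        · rintro ((hf | hf) | hf)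
          · refine ⟨Or.inl (Or.inr hf), ?_⟩
            rintro rfl
            exact Set.disjoint_left.1 hpq hep hf
          · refine ⟨Or.inr hf, ?_⟩
            rintro rfl
            exact Set.disjoint_left.1 hpr hep hf
          · refine ⟨Or.inl (Or.inl (Or.inr hf)), ?_⟩
            rintro rfl
            exact hpe.1 hf
      rw [heq]
      have hcyc := hq.isSimpleClosed_append_reverse hne hr hqr hqrv
      refine linearIndepOn_union_edgeSet (linearIndepOn_of_isCycle hρ hcyc.isCycle
        (hunb _ ?_ hcyc.isCycle)) p' hpath.2 fun a ha ha' => ?_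
      · rw [edgeSet_append, edgeSet_reverse]
        exact Set.union_subset hqC hrC
      · rw [hcyc.vertexSetOf, mem_vertices, mem_support_append, support_reverse,
          List.mem_reverse] at ha'
        have hap : a ∈ (Walk.cons e h p').vertices := by simp [ha]
        have hxy : a ∈ ({x, y} : Set V) := ha'.elim (fun ha' => hpqv.subset ⟨hap, ha'⟩)
          fun ha' => hprv.subset ⟨hap, ha'⟩
        refine hxy.resolve_left ?_
        rintro rfl
        exact hpath.1 ha
    · rintro f ((hf | hf) | hf)
      · exact key _ q r hp hq hr hpC hqC hrC hpq hpr hqr hqrv f hf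
      · exact key q _ r hq hp hr hqC hpC hrC hpq.symm hqr hpr hprv f hf
      · exact key r _ q hr hp hq hrC hpC hqC hpr.symm hqr.symm hpq hpqv f hf

/-! #### Dependent sets contain frame circuits -/

/-- The gain of a walk to `u` depends only on its start, so it defines a potential on the component
of `u` in `Y`. Extension by `0` still annihilates all columns of `Y`, as no edge of `Y` leaves the
component. -/
theorem exists_linearMap_of_forall_walkGain_eq_one {Y : Set E} {u : V}
    (h : ∀ p : Walk G u u, p.edgeSet ⊆ Y → χ.walkGain p = 1) :
    ∃ f : (V →₀ F) →ₗ[F] F, (∀ v ∈ frameSpan D χ ρ Y, f v = 0) ∧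
      (∀ a (p : Walk G a u), p.edgeSet ⊆ Y → ∀ c,
        f (Finsupp.single a c) = c * ρ (χ.walkGain p)) ∧
      ∀ a, (∀ p : Walk G a u, ¬ p.edgeSet ⊆ Y) → ∀ c, f (Finsupp.single a c) = 0 := by
  classical
  let g : V → F := fun a => if ha : ∃ p : Walk G a u, p.edgeSet ⊆ Y then
    ρ (χ.walkGain ha.choose) else 0
  have hg : ∀ a (p : Walk G a u), p.edgeSet ⊆ Y → g a = ρ (χ.walkGain p) := by
    intro a p hp
    have ha : ∃ p : Walk G a u, p.edgeSet ⊆ Y := ⟨p, hp⟩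
    have h1 : ∀ q : Walk G a u, q.edgeSet ⊆ Y → χ.walkGain q = (χ.walkGain p.reverse)⁻¹ := by
      intro q hq
      have := h (p.reverse.append q) (by
        rw [edgeSet_append, edgeSet_reverse]; exact Set.union_subset hp hq)
      rw [GainFunction.walkGain_append] at this
      exact (inv_eq_of_mul_eq_one_right this).symm
    simp only [g, dif_pos ha]
    rw [h1 _ ha.choose_spec, h1 p hp]
  have hg0 : ∀ a, (∀ p : Walk G a u, ¬ p.edgeSet ⊆ Y) → g a = 0 := by
    intro a ha
    have ha : ¬ ∃ p : Walk G a u, p.edgeSet ⊆ Y := by push Not; exact ha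
    simp only [g, dif_neg ha]
  let f : (V →₀ F) →ₗ[F] F := Finsupp.linearCombination F g
  have hf : ∀ a c, f (Finsupp.single a c) = c * g a := fun a c => by
    simp [f, Finsupp.linearCombination_single]
  refine ⟨f, fun v hv => ?_, fun a p hp c => by rw [hf, hg a p hp],
    fun a ha c => by rw [hf, hg0 a ha, mul_zero]⟩
  have hle : frameSpan D χ ρ Y ≤ LinearMap.ker f := by
    rw [frameSpan, Submodule.span_le]
    rintro _ ⟨e, he, rfl⟩
    rw [SetLike.mem_coe, LinearMap.mem_ker, frameVector]
    split_ifs with heG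
    · have hl := D.isLink ⟨e, heG⟩
      set a := D.tail ⟨e, heG⟩
      set b := D.head ⟨e, heG⟩
      rw [map_sub, hf, hf, one_mul, sub_eq_zero]
      by_cases hb : ∃ p : Walk G b u, p.edgeSet ⊆ Y
      · obtain ⟨p, hp⟩ := hb
        rw [hg b p hp, hg a (Walk.cons e hl p) (by
          rw [edgeSet_cons]; exact Set.insert_subset he hp), GainFunction.walkGain_cons, map_mul,
          Units.val_mul]
      · push Not at hb
        rw [hg0 b hb, mul_zero, hg0 a]
        intro p hp
        refine hb (Walk.cons e hl.symm p) ?_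
        rw [edgeSet_cons]
        exact Set.insert_subset he hp
    · exact map_zero f
  exact hle hv

theorem exists_isFrameCircuit_subset (hρ : Function.Injective ρ) {X : Set E} (hX : X ⊆ G.edgeSet)
    (hdep : ¬ LinearIndepOn F (frameVector D χ ρ) X) : ∃ C ⊆ X, χ.IsFrameCircuit C := by
  by_cases hbal : ∃ C ⊆ X, χ.IsBalancedCycle C
  · obtain ⟨C, hCX, hC⟩ := hbal
    exact ⟨C, hCX, Or.inl hC⟩
  push Not at hbal
  -- Without balanced cycles in `X`, any handcuff or theta graph in `X` is a frame circuit.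
  suffices ∃ C ⊆ X, IsHandcuff G C ∨ IsTheta G C by
    obtain ⟨C, hCX, hC⟩ := this
    exact ⟨C, hCX, Or.inr ⟨hC, fun C' hC' _ => hbal C' (hC'.trans hCX)⟩⟩
  obtain ⟨e, he, hmem⟩ := exists_mem_span_of_not_linearIndepOn hdep
  change frameVector D χ ρ e ∈ frameSpan D χ ρ (X \ {e}) at hmem
  have hsub : X \ {e} ⊆ X := Set.sdiff_subset
  obtain ⟨u, v, h⟩ := G.exists_isLink_of_mem_edgeSet (hX he)
  obtain ⟨k, -, hk⟩ := exists_smul_frameVector_eq (D := D) (χ := χ) (ρ := ρ) h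
  have hmem' := (frameSpan D χ ρ (X \ {e})).smul_mem k hmem
  rw [hk] at hmem'
  -- If `u` and `v` are joined without `e`, then `e` closes a cycle. Were all closed walks at `u`
  -- avoiding `e` of gain `1`, the functional would show this cycle to be balanced; so there is a
  -- second cycle, avoiding `e`, in the same component.
  by_cases hw : ∃ p : Walk G v u, p.edgeSet ⊆ X \ {e}
  · obtain ⟨p', hp'⟩ := hw
    obtain ⟨p, hp, hpp'⟩ := p'.exists_isPath
    have hpY := hpp'.trans hp'
    have hcyc : (Walk.cons e h p).IsSimpleClosed :=
      isSimpleClosed_cons.2 ⟨fun hep => (hpY hep).2 rfl, hp⟩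
    have hcycX : (Walk.cons e h p).edgeSet ⊆ X := by
      rw [edgeSet_cons]
      exact Set.insert_subset he (hpY.trans hsub)
    have hclosed : ∃ w : Walk G u u, w.edgeSet ⊆ X \ {e} ∧ χ.walkGain w ≠ 1 := by
      by_contra! hone
      obtain ⟨f, hf0, hf1, -⟩ := exists_linearMap_of_forall_walkGain_eq_one (D := D) (ρ := ρ)
        hone
      have h1 := hf0 _ hmem'
      rw [map_sub, hf1 u (Walk.nil h.left_mem) (by simp), hf1 v p hpY, GainFunction.walkGain_nil,
        map_one, Units.val_one, mul_one, ← Units.val_mul, ← map_mul, sub_eq_zero] at h1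
      refine hbal _ hcycX ⟨u, _, hcyc, rfl, hρ ?_⟩
      rw [map_one, GainFunction.walkGain_cons]
      exact Units.ext h1.symm
    obtain ⟨w, hwY, hw1⟩ := hclosed
    obtain ⟨a, q, c, hc, -, hq, hcw⟩ := χ.exists_isSimpleClosed_of_walkGain_ne_one w hw1
    exact exists_isHandcuff_or_isTheta_subset hcyc hc hcycX ((hcw.trans hwY).trans hsub)
      (fun hec => (hwY (hcw hec)).2 rfl) q ((hq.trans hwY).trans hsub)
  · push Not at hw
    have hw' : ∀ p : Walk G u v, ¬ p.edgeSet ⊆ X \ {e} := fun p hp =>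
      hw p.reverse (by rwa [edgeSet_reverse])
    -- If `e` is a bridge, a functional supported on the component of one end alone is nonzero on
    -- the column of `e`. So each side has a closed walk of gain other than `1`, hence a cycle, and
    -- `e` links the two cycles in a loose handcuff.
    have hu : ∃ w : Walk G u u, w.edgeSet ⊆ X \ {e} ∧ χ.walkGain w ≠ 1 := by
      by_contra! hone
      obtain ⟨f, hf0, hf1, hf2⟩ := exists_linearMap_of_forall_walkGain_eq_one (D := D) (ρ := ρ)
        hone
      have h1 := hf0 _ hmem'
      rw [map_sub, hf1 u (Walk.nil h.left_mem) (by simp), hf2 v hw] at h1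
      simp at h1
    have hv : ∃ w : Walk G v v, w.edgeSet ⊆ X \ {e} ∧ χ.walkGain w ≠ 1 := by
      by_contra! hone
      obtain ⟨f, hf0, hf1, hf2⟩ := exists_linearMap_of_forall_walkGain_eq_one (D := D) (ρ := ρ)
        hone
      have h1 := hf0 _ hmem'
      rw [map_sub, hf1 v (Walk.nil h.right_mem) (by simp), hf2 u hw'] at h1
      simp at h1
    obtain ⟨w₁, hw₁, hw₁'⟩ := hu
    obtain ⟨w₂, hw₂, hw₂'⟩ := hv
    obtain ⟨a, q₁, c₁, hc₁, -, hq₁, hcw₁⟩ := χ.exists_isSimpleClosed_of_walkGain_ne_one w₁ hw₁'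
    obtain ⟨b, q₂, c₂, hc₂, -, hq₂, hcw₂⟩ := χ.exists_isSimpleClosed_of_walkGain_ne_one w₂ hw₂'
    have hq₁Y := hq₁.trans hw₁
    have hq₂Y := hq₂.trans hw₂
    have hc₁Y := hcw₁.trans hw₁
    have hc₂Y := hcw₂.trans hw₂
    obtain ⟨C, hCX, hC⟩ := exists_isLooseHandcuff_subset hc₁.isCycle hc₂.isCycle
      -- A common vertex of the cycles would join `u` and `v` without `e`.
      (hc₁Y.trans hsub) (hc₂Y.trans hsub) (by
        rw [Set.disjoint_left, hc₁.vertexSetOf, hc₂.vertexSetOf]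
        intro z hz₁ hz₂
        obtain ⟨r₁, s₁, rfl⟩ := exists_eq_append hz₁
        obtain ⟨r₂, s₂, rfl⟩ := exists_eq_append hz₂
        rw [edgeSet_append, Set.union_subset_iff] at hc₁Y hc₂Y
        refine hw' ((q₁.append r₁).append (q₂.append r₂).reverse) ?_
        rw [edgeSet_append, edgeSet_reverse, edgeSet_append, edgeSet_append]
        exact Set.union_subset (Set.union_subset hq₁Y hc₁Y.1) (Set.union_subset hq₂Y hc₂Y.1))
      (a := a) (b := b) (by rw [hc₁.vertexSetOf]; simp) (by rw [hc₂.vertexSetOf]; simp)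
      (q₁.reverse.append (Walk.cons e h q₂)) (by
        rw [edgeSet_append, edgeSet_reverse, edgeSet_cons]
        exact Set.union_subset (hq₁Y.trans hsub) (Set.insert_subset he (hq₂Y.trans hsub)))
    exact ⟨C, hCX, Or.inl (Or.inr hC)⟩

theorem isFrameMatroid_linearMatroid (hρ : Function.Injective ρ) :
    χ.IsFrameMatroid (linearMatroid F (frameVector D χ ρ) hS) := by
  have hcirc : ∀ C, χ.IsFrameCircuit C → (linearMatroid F (frameVector D χ ρ) hS).IsCircuit C := by
    rintro C (hC | ⟨hC | hC, hunb⟩)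
    · exact isCircuit_of_isBalancedCycle hS hC
    · exact isCircuit_of_isHandcuff hS hρ hC hunb
    · exact isCircuit_of_isTheta hS hρ hC hunb
  refine ⟨rfl, fun C => ⟨fun hC => ?_, hcirc C⟩⟩
  obtain ⟨C', hC'C, hC'⟩ := exists_isFrameCircuit_subset hρ hC.subset_ground
    ((linearMatroid_dep_iff hC.subset_ground).1 hC.dep)
  rwa [← (hcirc C' hC').eq_of_subset_isCircuit hC hC'C]

end Frame

/-! ### The Frobenius partition of the affine group -/

section AffineGroup

variable {F : Type*} [Field F]

theorem AffineGroup.ext_trans_scale {g h : AffineGroup F}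
    (ht : AffineGroup.trans g = AffineGroup.trans h)
    (hs : AffineGroup.scale g = AffineGroup.scale h) : g = h :=
  SemidirectProduct.ext ht (Units.ext hs)

theorem AffineGroup.smul_def (g : AffineGroup F) (x : F) :
    g • x = AffineGroup.trans g + AffineGroup.scale g * x := rfl

theorem mem_translations_iff {g : AffineGroup F} :
    g ∈ translations F ↔ AffineGroup.scale g = 1 := by
  rw [translations, SemidirectProduct.range_inl_eq_ker_rightHom, MonoidHom.mem_ker]
  exact Units.val_eq_one.symm

/-- The translation by `x`. -/
def AffineGroup.translation (x : F) : AffineGroup F :=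
  SemidirectProduct.inl (Multiplicative.ofAdd x)

theorem AffineGroup.translation_smul_zero (x : F) : AffineGroup.translation x • (0 : F) = x := by
  rw [AffineGroup.smul_def, mul_zero, add_zero]
  rfl

/-- A non-identity element (a, b) has no fixed point if b = 1, and exactly the fixed point a / (1 −
b) otherwise. Malnormality follows: if `a ≠ 1` and its conjugate by `g` both fix `x`, then `a` fixes
`x` and `g • x`, so `g` fixes `x`. -/
theorem isFrobeniusPartition_translations_pointStabilizers :
    IsFrobeniusPartition (translations F) (pointStabilizers F) := by
  have hone : ∀ {g : AffineGroup F}, AffineGroup.scale g = 1 → ∀ x : F, g • x = x → g = 1 := by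
    intro g hg x hx
    rw [AffineGroup.smul_def, hg, one_mul, add_eq_right] at hx
    exact AffineGroup.ext_trans_scale hx hg
  have huniq : ∀ {g : AffineGroup F}, g ≠ 1 → ∀ x y : F, g • x = x → g • y = y → x = y := by
    intro g hg x y hx hy
    by_contra hne
    refine hg (hone ?_ x hx)
    rw [AffineGroup.smul_def] at hx hy
    have : (AffineGroup.scale g - 1) * (x - y) = 0 := by linear_combination hx - hy
    obtain h | h := mul_eq_zero.1 this
    · exact sub_eq_zero.1 h
    · exact absurd (sub_eq_zero.1 h) hne
  refine ⟨inferInstance, ?_, ?_, ?_⟩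
  · intro g hg
    by_cases hs : AffineGroup.scale g = 1
    · refine ⟨translations F, ⟨Set.mem_insert _ _, mem_translations_iff.2 hs⟩, ?_⟩
      rintro A ⟨rfl | ⟨x, rfl⟩, hA⟩
      · rfl
      · exact absurd (hone hs x hA) hg
    · have hs' : (1 : F) - AffineGroup.scale g ≠ 0 := sub_ne_zero.2 (Ne.symm hs)
      have hfix : g • (AffineGroup.trans g / (1 - AffineGroup.scale g)) =
          AffineGroup.trans g / (1 - AffineGroup.scale g) := by
        rw [AffineGroup.smul_def]
        field_simp
        ring
      refine ⟨MulAction.stabilizer (AffineGroup F)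
        (AffineGroup.trans g / (1 - AffineGroup.scale g)), ⟨Or.inr ⟨_, rfl⟩, hfix⟩, ?_⟩
      rintro A ⟨rfl | ⟨x, rfl⟩, hA⟩
      · exact absurd (mem_translations_iff.1 hA) hs
      · rw [huniq hg x _ hA hfix]
  · rintro _ ⟨x, rfl⟩ g hg a ha hga
    by_contra hne
    have ha1 : a ≠ 1 := by
      rintro rfl
      simp at hne
    refine hg (huniq ha1 (g • x) x ?_ ha)
    have hga : (g⁻¹ * a * g) • x = x := hga
    rwa [mul_smul, mul_smul, inv_smul_eq_iff] at hga
  · rintro _ ⟨x, rfl⟩ g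
    exact ⟨g • x, MulAction.stabilizer_smul_eq_stabilizer_map_conj g x⟩

/-- The scaling factor, as an injective homomorphism on the quotient by the translations. -/
def scaleHom (F : Type*) [Field F] : AffineGroup F ⧸ translations F →* Fˣ :=
  QuotientGroup.lift (translations F) SemidirectProduct.rightHom fun _ hg =>
    Units.ext (mem_translations_iff.1 hg)

theorem scaleHom_mk (g : AffineGroup F) :
    (scaleHom F (g : AffineGroup F ⧸ translations F) : F) = AffineGroup.scale g := rfl

theorem scaleHom_injective : Function.Injective (scaleHom F) := by
  rw [injective_iff_map_eq_one]
  intro a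
  induction a using QuotientGroup.induction_on with
  | H g =>
    intro h
    rw [QuotientGroup.eq_one_iff, mem_translations_iff, ← scaleHom_mk, h, Units.val_one]

end AffineGroup

/-! ### The matroid of a gain graph over the affine group -/

section Main

variable {F : Type*} [Field F] {V E : Type*} {G : Graph V E}

open Classical in
/-- The row `v₀` of the incidence matrix. -/
noncomputable def transRow (D : Orientation G) (ψ : GainFunction G (AffineGroup F)) (e : E) : F :=
  if h : e ∈ G.edgeSet then
    AffineGroup.trans (ψ.gain e (D.tail ⟨e, h⟩) (D.head ⟨e, h⟩))
  else 0

/-- The frame vectors of the multiplicative parts of the gains. -/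
noncomputable def scaleVector (D : Orientation G) (ψ : GainFunction G (AffineGroup F)) :
    E → V →₀ F :=
  frameVector D (ψ.quotient (translations F)) (scaleHom F)

variable {D : Orientation G} {ψ : GainFunction G (AffineGroup F)}

theorem scaleVector_of_mem {e : E} (h : e ∈ G.edgeSet) :
    scaleVector D ψ e = Finsupp.single (D.tail ⟨e, h⟩) 1 - Finsupp.single (D.head ⟨e, h⟩)
      (AffineGroup.scale (ψ.gain e (D.tail ⟨e, h⟩) (D.head ⟨e, h⟩))) := by
  rw [scaleVector, frameVector, dif_pos h]
  rfl

/-- A functional is given by its values on the unit vectors, and prescribing its value on the column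
of an edge is the potential equation along that edge. -/
theorem exists_linearMap_iff_exists_isPotential {C : Set E} (hC : C ⊆ G.edgeSet) :
    (∃ f : (V →₀ F) →ₗ[F] F, ∀ e ∈ C, f (scaleVector D ψ e) = transRow D ψ e) ↔
      ∃ g : V → F, ψ.IsPotential C g := by
  constructor
  · rintro ⟨f, hf⟩
    refine ⟨fun a => f (Finsupp.single a 1), fun e he a b hab => ?_⟩
    refine GainFunction.gain_smul_eq_of_isLink (ψ := ψ) (g := fun a => f (Finsupp.single a 1))
      (D.isLink ⟨e, hC he⟩) ?_ hab
    have h1 := hf e he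
    have h2 : ∀ a (c : F), f (Finsupp.single a c) = c * f (Finsupp.single a 1) := fun a c => by
      rw [← smul_eq_mul, ← map_smul, Finsupp.smul_single, smul_eq_mul, mul_one]
    rw [scaleVector_of_mem (hC he), transRow, dif_pos (hC he), map_sub,
      h2 (D.head _) (AffineGroup.scale _)] at h1
    rw [AffineGroup.smul_def]
    linear_combination h1
  · rintro ⟨g, hg⟩
    refine ⟨Finsupp.linearCombination F g, fun e he => ?_⟩
    have h1 := hg e he _ _ (D.isLink ⟨e, hC he⟩)
    rw [AffineGroup.smul_def] at h1
    rw [scaleVector_of_mem (hC he), transRow, dif_pos (hC he), map_sub,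
      Finsupp.linearCombination_single, Finsupp.linearCombination_single, smul_eq_mul, smul_eq_mul]
    linear_combination h1

theorem mem_circuitClass_iff {C : Set E}
    (hC : (ψ.quotient (translations F)).IsFrameCircuit C) :
    C ∈ ψ.circuitClass (translations F) (pointStabilizers F) ↔
      ∃ g : V → F, ψ.IsPotential C g := by
  constructor
  · rintro ⟨-, hbal | ⟨-, η, _, ⟨z, rfl⟩, hη⟩⟩
    · exact hbal.exists_isPotential
    · refine ⟨fun a => η a • z, fun e he a b hab => ?_⟩
      have h1 : ((η a)⁻¹ * ψ.gain e a b * η b) • z = z := hη ⟨e, he, a, b, hab, rfl⟩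
      rw [mul_smul, mul_smul, inv_smul_eq_iff] at h1
      exact h1.symm
  · rintro ⟨g, hg⟩
    refine ⟨hC, ?_⟩
    obtain ⟨x, p, hp, rfl, hgain⟩ | ⟨h, -⟩ := hC
    · refine Or.inl ⟨x, p, hp, rfl, ?_⟩
      rw [ψ.walkGain_quotient, QuotientGroup.eq_one_iff, mem_translations_iff] at hgain
      have h1 := hg.eq_walkGain_smul p subset_rfl
      -- The gain is a translation that fixes `g x`, so it is the identity.
      rw [AffineGroup.smul_def, hgain, one_mul, right_eq_add] at h1
      exact AffineGroup.ext_trans_scale h1 hgain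
    -- Translation by `g a` carries `0` to `g a`, so the switched gains fix `0`.
    · refine Or.inr ⟨h, fun a => AffineGroup.translation (g a), _, ⟨0, rfl⟩, ?_⟩
      rintro _ ⟨e, he, a, b, hab, rfl⟩
      change ((AffineGroup.translation (g a))⁻¹ * ψ.gain e a b *
        AffineGroup.translation (g b)) • (0 : F) = 0
      rw [mul_smul, mul_smul, AffineGroup.translation_smul_zero, inv_smul_eq_iff,
        AffineGroup.translation_smul_zero, hg e he a b hab]

theorem isGainMatroid_linearMatroid (hG : G.edgeSet.Finite) :
    IsGainMatroid (translations F) (pointStabilizers F) ψ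
      (linearMatroid F (fun e => (scaleVector D ψ e, transRow D ψ e)) hG) := by
  have hN : (ψ.quotient (translations F)).IsFrameMatroid
      (linearMatroid F (scaleVector D ψ) hG) :=
    isFrameMatroid_linearMatroid hG scaleHom_injective
  refine ⟨_, hN, ?_⟩
  convert linearMatroid_isLiftOf (F := F) (φ := scaleVector D ψ) (hS := hG) (α := transRow D ψ)
    using 1
  ext C
  constructor
  · intro hC
    have hcirc := (hN.2 C).2 hC.1
    refine ⟨hcirc, (linearMatroid_lift_not_indep_iff hcirc).2 ?_⟩
    rw [exists_linearMap_iff_exists_isPotential hcirc.subset_ground]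
    exact (mem_circuitClass_iff hC.1).1 hC
  · rintro ⟨hcirc, hC⟩
    rw [linearMatroid_lift_not_indep_iff hcirc,
      exists_linearMap_iff_exists_isPotential hcirc.subset_ground] at hC
    exact (mem_circuitClass_iff ((hN.2 C).1 hcirc)).2 hC

/-- The frame matroid is determined by its circuits and the lift by its rank function, since a
finite set is independent exactly if its rank equals its size. -/
theorem IsGainMatroid.eq (hG : G.edgeSet.Finite) {Γ : Type*} [Group Γ] {Γ₁ : Subgroup Γ}
    [Γ₁.Normal] {𝒜 : Set (Subgroup Γ)} {ψ : GainFunction G Γ} {M M' : Matroid E}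
    (h : IsGainMatroid Γ₁ 𝒜 ψ M) (h' : IsGainMatroid Γ₁ 𝒜 ψ M') : M = M' := by
  obtain ⟨N, hN, -, hE, hr⟩ := h
  obtain ⟨N', hN', -, hE', hr'⟩ := h'
  obtain rfl : N = N' := Matroid.ext_isCircuit (hN.1.trans hN'.1.symm) fun C _ =>
    (hN.2 C).trans (hN'.2 C).symm
  refine Matroid.ext_indep (hE.trans hE'.symm) fun I hI => ?_
  have hI' : I ⊆ N.E := hI.trans hE.subset
  have hfin : I.Finite := hG.subset (hI'.trans hN.1.subset)
  rw [Matroid.indep_iff_eRk_eq_encard_of_finite hfin,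
    Matroid.indep_iff_eRk_eq_encard_of_finite hfin, hr I hI', hr' I hI']

/-- Extending functions on the rows of the incidence matrix by `0` to all of `V`. -/
theorem exists_injective_linearMap_incidenceMatrix (D : Orientation G)
    (ψ : GainFunction G (AffineGroup F)) :
    ∃ T : (Option G.vertexSet → F) →ₗ[F] (V → F) × F, Function.Injective T ∧
      ∀ e : G.edgeSet, T ((incidenceMatrix D ψ).col e) =
        (⇑(scaleVector D ψ e), transRow D ψ e) := by
  classical
  let T : (Option G.vertexSet → F) →ₗ[F] (V → F) × F :=
    { toFun := fun x => (fun v => if h : v ∈ G.vertexSet then x (some ⟨v, h⟩) else 0, x none)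
      map_add' := fun x y => by
        refine Prod.ext (funext fun v => ?_) rfl
        by_cases h : v ∈ G.vertexSet <;> simp [h]
      map_smul' := fun c x => by
        refine Prod.ext (funext fun v => ?_) rfl
        by_cases h : v ∈ G.vertexSet <;> simp [h] }
  refine ⟨T, ?_, ?_⟩
  · intro x y hxy
    funext r
    cases r with
    | none => exact congrArg Prod.snd hxy
    | some v =>
      have := congrFun (congrArg Prod.fst hxy) v
      simpa [T] using this
  · rintro ⟨e, he⟩
    have hl := D.isLink ⟨e, he⟩
    refine Prod.ext (funext fun v => ?_) ?_
    · change (if h : v ∈ G.vertexSet then incidenceMatrix D ψ (some ⟨v, h⟩) ⟨e, he⟩ else 0) =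
        scaleVector D ψ e v
      rw [scaleVector_of_mem he, Finsupp.sub_apply, Finsupp.single_apply, Finsupp.single_apply]
      by_cases hv : v ∈ G.vertexSet
      · rw [dif_pos hv]
        simp only [incidenceMatrix]
        rw [eq_comm (a := D.tail _), eq_comm (a := D.head _)]
        by_cases h1 : v = D.tail ⟨e, he⟩ <;> by_cases h2 : v = D.head ⟨e, he⟩
        · rw [if_neg fun h => h.2 h2, if_neg fun h => h.2 h1, if_pos ⟨h1, h2⟩, if_pos h1, if_pos h2]
        · rw [if_pos ⟨h1, h2⟩, if_pos h1, if_neg h2, sub_zero]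
        · rw [if_neg fun h => h1 h.1, if_pos ⟨h2, h1⟩, if_neg h1, if_pos h2, zero_sub]
        · rw [if_neg fun h => h1 h.1, if_neg fun h => h2 h.1, if_neg fun h => h1 h.1, if_neg h1,
            if_neg h2, sub_zero]
      · have h1 : D.tail ⟨e, he⟩ ≠ v := by
          rintro rfl
          exact hv hl.left_mem
        have h2 : D.head ⟨e, he⟩ ≠ v := by
          rintro rfl
          exact hv hl.right_mem
        rw [dif_neg hv, if_neg h1, if_neg h2, sub_zero]
    · change AffineGroup.trans _ = transRow D ψ e
      rw [transRow, dif_pos he]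

/-- The matrix has rows only for vertices of `G`, whereas the vectors are finitely supported on all
of `V`. Both embed linearly into `(V → F) × F`, where the columns coincide. -/
theorem represents_incidenceMatrix (hG : G.edgeSet.Finite) :
    Represents (incidenceMatrix D ψ)
      (linearMatroid F (fun e => (scaleVector D ψ e, transRow D ψ e)) hG) := by
  refine ⟨rfl, fun I => ?_⟩
  obtain ⟨T, hT, hTcol⟩ := exists_injective_linearMap_incidenceMatrix D ψ
  let T' : (V →₀ F) × F →ₗ[F] (V → F) × F := Finsupp.lcoeFun.prodMap LinearMap.id
  have hT' : Function.Injective T' :=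
    Function.Injective.prodMap DFunLike.coe_injective Function.injective_id
  rw [linearMatroid_indep_iff, and_iff_right (by rintro _ ⟨e, -, rfl⟩; exact e.2)]
  have h1 : LinearIndepOn F (fun e => (scaleVector D ψ e, transRow D ψ e)) (Subtype.val '' I) ↔
      LinearIndepOn F (fun e : G.edgeSet => (scaleVector D ψ e, transRow D ψ e)) I :=
    (linearIndependent_equiv (Equiv.Set.image Subtype.val I Subtype.val_injective)).symm
  rw [h1, LinearIndepOn, LinearIndepOn,
    ← LinearMap.linearIndependent_iff T' (LinearMap.ker_eq_bot.2 hT'),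
    ← LinearMap.linearIndependent_iff T (LinearMap.ker_eq_bot.2 hT)]
  have h2 : (T ∘ fun e : I => (incidenceMatrix D ψ).col e) =
      T' ∘ fun e : I => (scaleVector D ψ e, transRow D ψ e) := funext fun e => hTcol e
  rw [h2]

end Main

end GainGraph

/-- For a gain graph `(G, ψ)` over `𝔽⁺ ⋊ 𝔽ˣ` the translations and the point stabilizers form a
Frobenius partition, the matroid `M(𝔽⁺ ⋊ 𝔽ˣ, 𝔽⁺, 𝒜, G, ψ)` exists and is unique, and the incidence
matrix `A(D, ψ)` represents it over `𝔽`. -/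
theorem mainTheorem4 {F : Type*} [Field F] {V E : Type*} (G : Graph V E)
    (hG : G.edgeSet.Finite) (ψ : GainGraph.GainFunction G (GainGraph.AffineGroup F))
    (D : GainGraph.Orientation G) :
    GainGraph.IsFrobeniusPartition (GainGraph.translations F) (GainGraph.pointStabilizers F) ∧
      (∃! M : Matroid E,
        GainGraph.IsGainMatroid (GainGraph.translations F) (GainGraph.pointStabilizers F) ψ M) ∧
      ∀ M : Matroid E,
        GainGraph.IsGainMatroid (GainGraph.translations F) (GainGraph.pointStabilizers F) ψ M →
          GainGraph.Represents (GainGraph.incidenceMatrix D ψ) M := by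
  have hM := GainGraph.isGainMatroid_linearMatroid (D := D) (ψ := ψ) hG
  refine ⟨GainGraph.isFrobeniusPartition_translations_pointStabilizers,
    ⟨_, hM, fun M h => h.eq hG hM⟩, fun M h => ?_⟩
  rw [h.eq hG hM]
  exact GainGraph.represents_incidenceMatrix hG
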